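/- Let $D$ be a finite digraph without loops and without parallel edges (pairs of anti-parallel edges $(u,v),(v,u)$ are allowed). For a vertex $v$ let $N^+(v)$ be its set of out-neighbors and $d^+(v)$, $d^-(v)$ its out- and in-degree. Let $\Delta^+(D)=\max_v d^+(v)$, $\Delta(D)=\max_v (d^+(v)+d^-(v))$, and let $\Delta(U(D))$ be the maximum degree of the underlying simple graph $U(D)$, in which distinct vertices $x,y$ are adjacent iff $(x,y)$ or $(y,x)$ is an edge of $D$. A majority coloring of $D$ is a vertex coloring $c$ such that for every vertex $v$ at most half of the vertices $w\in N^+(v)$ satisfy $c(w)=c(v)$. The digraph $D$ is majority $3$-colorable if it has a majority coloring with $3$ colors, and majority $3$-choosable if for every assignment of (finite) color lists $L(v)$ with $|L(v)|\ge 3$ to the vertices there is a majority coloring $c$ with $c(v)\in L(v)$ for all $v$. If $\Delta^+(D)\le 4$, or $\Delta(U(D))\le 6$, or $\Delta(D)\le 7$, then $D$ is majority $3$-choosable. In particular, if $d^+(v)=d^-(v)=3$ for all vertices $v$, or $d^+(v)=d^-(v)=4$ for all vertices $v$ (that is, if $D$ is $3$-regular or $4$-regular), then $D$ is majority $3$-colorable.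 -/

import Mathlib

universe u w

namespace Digraph

variable {V : Type*} [Fintype V]

open Classical in
/-- The out-neighborhood `N⁺(v)` of a vertex of a finite digraph. -/
noncomputable def outNeighbors (D : Digraph V) (v : V) : Finset V :=
  Finset.univ.filter fun w => D.Adj v w

open Classical in
/-- The in-neighborhood `N⁻(v)` of a vertex of a finite digraph. -/
noncomputable def inNeighbors (D : Digraph V) (v : V) : Finset V :=
  Finset.univ.filter fun w => D.Adj w v

/-- The out-degree `d⁺(v)`. -/
noncomputable def outDeg (D : Digraph V) (v : V) : ℕ := (D.outNeighbors v).card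

/-- The in-degree `d⁻(v)`. -/
noncomputable def inDeg (D : Digraph V) (v : V) : ℕ := (D.inNeighbors v).card

/-- The maximum out-degree `Δ⁺(D)` (equal to `0` if there are no vertices). -/
noncomputable def maxOutDeg (D : Digraph V) : ℕ := Finset.univ.sup fun v => D.outDeg v

/-- The maximum degree `Δ(D) = max_v (d⁺(v) + d⁻(v))` (equal to `0` if there are no vertices). -/
noncomputable def maxDeg (D : Digraph V) : ℕ :=
  Finset.univ.sup fun v => D.outDeg v + D.inDeg v

/-- `D` is `r`-regular: every vertex has out-degree and in-degree `r`. -/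
def IsRegular (D : Digraph V) (r : ℕ) : Prop := ∀ v, D.outDeg v = r ∧ D.inDeg v = r

open Classical in
/-- A majority coloring: for every vertex `v`, at most half of the out-neighbors of `v` have the
same color as `v`. -/
def IsMajorityColoring {α : Type*} (D : Digraph V) (c : V → α) : Prop :=
  ∀ v, 2 * ((D.outNeighbors v).filter fun w => c w = c v).card ≤ D.outDeg v

/-- `D` has a majority coloring with `k` colors. -/
def IsMajorityColorable (D : Digraph V) (k : ℕ) : Prop :=
  ∃ c : V → Fin k, D.IsMajorityColoring c

end Digraph

/-- `D` is majority `k`-choosable: for every assignment of lists of at least `k` colors to the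
vertices there is a majority coloring that takes the color of each vertex from its list. -/
def Digraph.IsMajorityChoosable {V : Type u} [Fintype V] (D : Digraph V) (k : ℕ) : Prop :=
  ∀ (α : Type w) (L : V → Finset α), (∀ v, k ≤ (L v).card) →
    ∃ c : V → α, (∀ v, c v ∈ L v) ∧ D.IsMajorityColoring c

/-! Drop one out-neighbor wherever the out-degree is even and positive. The out-degrees become odd
or zero, and it suffices that at most `(N v).card / 2` of the remaining out-neighbors share the
color of `v`. If `v` has two candidate colors and out-degree at most `2 * b + 1`, then at most one
of the two can occur more than `b` times on its out-neighbors.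

Give each vertex an ordered pair (default, alternative) of distinct colors from its list of three;
there are six such pairs. If adjacent vertices have different pairs, then unsatisfied vertices can
switch to the alternative one by one, and no switch need be revoked: an out-neighbor now showing the
default color of `v` can never move to the alternative of `v`, since that would require the same
ordered pair (`exists_coloring_of_pairs`). So a list coloring of the underlying graph `G` with lists
of size six is wanted.

Parts of `G` in which some degree is below six are colored greedily. Out-degree at most three bounds
the average degree by six, so only 6-regular parts resist, and Brooks' theorem for lists
(`exists_listColoring_or_clique`) handles these, except copies of `K₇` with equal lists. When total
degrees are at most seven, vertices of out-degree at least five have in-degree at most two. A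
maximal acyclic set `F` of them is set aside (`exists_acyclic_set`): its vertices choose freely
between two colors in rank order and only have to avoid the unordered pairs of their at most two
in-neighbors. A remaining vertex of large out-degree loses two of its at most seven arcs to `F`.

A bad `K₇` has no leaving arc, so it can be colored on its own
(`exists_majority_coloring_of_seven`). Starting from a largest out-closed set `S` that can already
be colored excludes this case. -/

namespace MajorityColoring

/-! ### Switching between two candidate colors -/

open scoped Classical in
/-- Vertices of an acyclic set, each of which may switch freely between two colors, can be satisfied
one after the other, whatever the colors of the other vertices are. -/
theorem exists_flexible_extension {V : Type*} {α : Type*} (N : V → Finset V) (b : V → ℕ)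
    (p q : V → α) (ρ : V → ℕ) (g : V → α) (F : Finset V) (hpq : ∀ v ∈ F, p v ≠ q v)
    (hρ : ∀ v ∈ F, ∀ w ∈ N v, w ∈ F → ρ w < ρ v) (hN : ∀ v ∈ F, (N v).card ≤ 2 * b v + 1) :
    ∃ c : V → α, (∀ v, v ∉ F → c v = g v) ∧
      ∀ v ∈ F, (c v = p v ∨ c v = q v) ∧ ((N v).filter fun w => c w = c v).card ≤ b v := by
  induction hn : F.card generalizing F with
  | zero =>
    rw [Finset.card_eq_zero] at hn
    subst hn
    exact ⟨g, by simp, by simp⟩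
  | succ n ih =>
    have hne : F.Nonempty := by rw [← Finset.card_pos]; omega
    -- A vertex of top rank is an out-neighbor of no vertex of `F`, so it can be colored last
    -- without disturbing the others.
    obtain ⟨v, hv, hmax⟩ := Finset.exists_max_image F ρ hne
    obtain ⟨c, hc, hF⟩ := ih (F.erase v) (fun w hw => hpq w (Finset.mem_of_mem_erase hw))
      (fun w hw x hx hxF => hρ w (Finset.mem_of_mem_erase hw) x hx (Finset.mem_of_mem_erase hxF))
      (fun w hw => hN w (Finset.mem_of_mem_erase hw)) (by rw [Finset.card_erase_of_mem hv]; omega)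
    have hnot : ∀ w ∈ F, v ∉ N w := fun w hw hvw =>
      absurd (hρ w hw v hvw hv) (not_lt.2 (hmax w hw))
    have hsum : ((N v).filter fun w => c w = p v).card + ((N v).filter fun w => c w = q v).card
        ≤ 2 * b v + 1 := by
      rw [← Finset.card_union_of_disjoint]
      · exact (Finset.card_le_card (Finset.union_subset (Finset.filter_subset _ _)
          (Finset.filter_subset _ _))).trans (hN v hv)
      · rw [Finset.disjoint_filter]
        intro w _ h1 h2
        exact hpq v hv (h1.symm.trans h2)
    obtain ⟨z, hz, hzb⟩ : ∃ z, (z = p v ∨ z = q v) ∧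
        ((N v).filter fun w => c w = z).card ≤ b v := by
      by_cases h : ((N v).filter fun w => c w = p v).card ≤ b v
      · exact ⟨_, Or.inl rfl, h⟩
      · exact ⟨_, Or.inr rfl, by omega⟩
    have hupd : ∀ x ∈ F, ∀ t, ((N x).filter fun w => Function.update c v z w = t) =
        (N x).filter fun w => c w = t := by
      intro x hx t
      refine Finset.filter_congr fun w hw => ?_
      rw [Function.update_of_ne]
      rintro rfl
      exact hnot x hx hw
    refine ⟨Function.update c v z, fun w hw => ?_, fun w hw => ?_⟩
    · have hwv : w ≠ v := by rintro rfl; exact hw hv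
      rw [Function.update_of_ne hwv]
      exact hc w fun h => hw (Finset.mem_of_mem_erase h)
    · rw [hupd w hw]
      by_cases hwv : w = v
      · subst hwv
        simpa using ⟨hz, hzb⟩
      · rw [Function.update_of_ne hwv]
        exact hF w (Finset.mem_erase.2 ⟨hwv, hw⟩)

open scoped Classical in
/-- A digraph (given by its out-neighborhoods `N`) whose vertices are precolored by `g`, except that
a vertex of `O` has a default color and an alternative color, and that a vertex of the acyclic set `F`
has two colors of equal rank. If no arc leads from a vertex of `O` to one with the same pair of colors
(ordered on `O`, unordered on `F`), then all vertices of `O` and `F` can be satisfied. -/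
theorem exists_coloring_of_pairs {V : Type*} {α : Type*} (N : V → Finset V) (b : V → ℕ)
    (g : V → α) (O F : Finset V) (hOF : Disjoint O F) (P : V → α × α) (R : V → α × α)
    (hP : ∀ v ∈ O, (P v).1 ≠ (P v).2) (hR : ∀ v ∈ F, (R v).1 ≠ (R v).2) (ρ : V → ℕ)
    (hρ : ∀ v ∈ F, ∀ w ∈ N v, w ∈ F → ρ w < ρ v)
    (hN : ∀ v, v ∈ O ∨ v ∈ F → (N v).card ≤ 2 * b v + 1)
    (hOO : ∀ v ∈ O, ∀ w ∈ N v, w ∈ O → P w ≠ P v)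
    (hOF' : ∀ v ∈ O, ∀ w ∈ N v, w ∈ F → R w ≠ P v ∧ R w ≠ (P v).swap) :
    ∃ c : V → α, (∀ v, v ∉ O → v ∉ F → c v = g v) ∧
      (∀ v ∈ O, c v = (P v).1 ∨ c v = (P v).2) ∧ (∀ v ∈ F, c v = (R v).1 ∨ c v = (R v).2) ∧
      ∀ v, v ∈ O ∨ v ∈ F → ((N v).filter fun w => c w = c v).card ≤ b v := by
  -- `B` is the set of vertices already switched for good. `may B w t` says that `w` could still end
  -- up with color `t`: both colors are open on `F` and on `O \ B`, only the alternative on `B`. The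
  -- invariant asks that switched vertices be satisfied in every possible future; a maximal `B`
  -- replaces the switching process.
  let may : Finset V → V → α → Prop := fun B w t =>
    if w ∈ F then t = (R w).1 ∨ t = (R w).2
    else if w ∈ O then (if w ∈ B then t = (P w).2 else t = (P w).1 ∨ t = (P w).2)
    else t = g w
  let inv : Finset V → Prop := fun B =>
    ∀ v ∈ B, ((N v).filter fun w => may B w (P v).2).card ≤ b v
  obtain ⟨B, hB, hmax⟩ := Finset.exists_max_image (O.powerset.filter inv) Finset.card
    ⟨∅, by simp [inv]⟩
  simp only [Finset.mem_filter, Finset.mem_powerset] at hB hmax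
  obtain ⟨hBO, hinv⟩ := hB
  obtain ⟨c, hc, hcF⟩ := exists_flexible_extension N b (fun v => (R v).1) (fun v => (R v).2) ρ
    (fun v => if v ∈ O then (if v ∈ B then (P v).2 else (P v).1) else g v) F hR hρ
    (fun v hv => hN v (Or.inr hv))
  have hO : ∀ v ∈ O, v ∉ F := fun v hv => Finset.disjoint_left.1 hOF hv
  have hmay : ∀ w, may B w (c w) := by
    intro w
    by_cases hwF : w ∈ F
    · simp only [may, if_pos hwF]; exact (hcF w hwF).1
    · by_cases hwO : w ∈ O
      · by_cases hwB : w ∈ B <;> simp [may, hwF, hwO, hwB, hc w hwF]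
      · simp [may, hwF, hwO, hc w hwF]
  refine ⟨c, fun v h1 h2 => by rw [hc v h2, if_neg h1], fun v hv => ?_, fun v hv => (hcF v hv).1, ?_⟩
  · rw [hc v (hO v hv), if_pos hv]
    split_ifs
    · exact Or.inr rfl
    · exact Or.inl rfl
  rintro v (hv | hv)
  swap
  · exact (hcF v hv).2
  by_cases hvB : v ∈ B
  · have hcv : c v = (P v).2 := by rw [hc v (hO v hv), if_pos hv, if_pos hvB]
    refine (Finset.card_le_card fun w hw => ?_).trans (hinv v hvB)
    rw [Finset.mem_filter] at hw ⊢
    refine ⟨hw.1, ?_⟩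
    rw [← hcv, ← hw.2]
    exact hmay w
  · have hcv : c v = (P v).1 := by rw [hc v (hO v hv), if_pos hv, if_neg hvB]
    by_contra hbad
    -- More than `b v` out-neighbors show the default color of `v`, and none of them can ever take
    -- its alternative. Hence at most `b v` others can, so `insert v B` keeps the invariant, against
    -- maximality.
    have hnot : ∀ w ∈ (N v).filter fun w => c w = c v, ¬ may (insert v B) w (P v).2 := by
      intro w hw
      rw [Finset.mem_filter, hcv] at hw
      obtain ⟨hwN, hwc⟩ := hw
      have hne := hP v hv
      by_cases hwF : w ∈ F
      · have h1 := (hcF w hwF).1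
        have h2 := hOF' v hv w hwN hwF
        have h3 := hR w hwF
        simp only [may, if_pos hwF]
        simp only [ne_eq, Prod.ext_iff, Prod.fst_swap, Prod.snd_swap] at h2
        rw [hwc] at h1
        grind
      · by_cases hwO : w ∈ O
        · have hwv : w ≠ v := by rintro rfl; exact hOO w hv w hwN hv rfl
          have h2 := hOO v hv w hwN hwO
          have h3 := hc w hwF
          rw [if_pos hwO, hwc] at h3
          simp only [ne_eq, Prod.ext_iff] at h2
          by_cases hwB : w ∈ B
          · simp only [may, if_neg hwF, if_pos hwO, Finset.mem_insert, hwB, or_true, if_true]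
            grind
          · simp only [may, if_neg hwF, if_pos hwO, Finset.mem_insert, hwB, hwv, or_false, if_false]
            grind
        · have h3 := hc w hwF
          rw [if_neg hwO, hwc] at h3
          simp only [may, if_neg hwF, if_neg hwO]
          rw [← h3]
          exact hne.symm
    have hmono : ∀ w t, may (insert v B) w t → may B w t := by
      intro w t
      simp only [may, Finset.mem_insert]
      grind
    have hcard : (insert v B).card ≤ B.card := by
      apply hmax
      refine ⟨Finset.insert_subset hv hBO, fun u hu => ?_⟩
      rw [Finset.mem_insert] at hu
      by_cases huv : u = v
      · subst huv
        have h1 : ((N u).filter fun w => may (insert u B) w (P u).2).card +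
            ((N u).filter fun w => c w = c u).card ≤ (N u).card := by
          rw [← Finset.card_union_of_disjoint]
          · exact Finset.card_le_card (Finset.union_subset (Finset.filter_subset _ _)
              (Finset.filter_subset _ _))
          · rw [Finset.disjoint_left]
            intro w hw hw'
            exact hnot w hw' (Finset.mem_filter.1 hw).2
        have h2 := hN u (Or.inl hv)
        omega
      · refine (Finset.card_le_card fun w hw => ?_).trans (hinv u (hu.resolve_left huv))
        rw [Finset.mem_filter] at hw ⊢
        exact ⟨hw.1, hmono w _ hw.2⟩
    rw [Finset.card_insert_of_notMem hvB] at hcard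
    omega

/-! ### Greedy extension of list colorings -/

section ListColoring

variable {V : Type*} {β : Type*} {G : SimpleGraph V} {Λ : V → Finset β}

/-- `f` is a proper list coloring of the subgraph of `G` induced by `A`. -/
def IsListColoringOn (G : SimpleGraph V) (Λ : V → Finset β) (A : Finset V) (f : V → β) : Prop :=
  (∀ x ∈ A, f x ∈ Λ x) ∧ ∀ x ∈ A, ∀ y ∈ A, G.Adj x y → f x ≠ f y

theorem IsListColoringOn.mono {A B : Finset V} {f : V → β} (hf : IsListColoringOn G Λ B f)
    (h : A ⊆ B) : IsListColoringOn G Λ A f :=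
  ⟨fun x hx => hf.1 x (h hx), fun x hx y hy => hf.2 x (h hx) y (h hy)⟩

open scoped Classical in
theorem IsListColoringOn.update {A : Finset V} {f : V → β} (hf : IsListColoringOn G Λ A f) {v : V}
    (hv : v ∉ A) {z : β} (hz : z ∈ Λ v) (hzA : ∀ y ∈ A, G.Adj v y → f y ≠ z) :
    (∀ x ∈ A, Function.update f v z x = f x) ∧
      IsListColoringOn G Λ (insert v A) (Function.update f v z) := by
  have hagree : ∀ x ∈ A, Function.update f v z x = f x := fun x hx =>
    Function.update_of_ne (by rintro rfl; exact hv hx) _ _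
  refine ⟨hagree, fun x hx => ?_, fun x hx y hy hxy => ?_⟩
  · rw [Finset.mem_insert] at hx
    rcases hx with rfl | hx
    · simpa using hz
    · rw [hagree x hx]; exact hf.1 x hx
  · rw [Finset.mem_insert] at hx hy
    rcases hx with rfl | hx <;> rcases hy with rfl | hy
    · exact absurd hxy (G.irrefl)
    · rw [hagree y hy, Function.update_self]; exact (hzA y hy hxy).symm
    · rw [hagree x hx, Function.update_self]; exact hzA x hx hxy.symm
    · rw [hagree x hx, hagree y hy]; exact hf.2 x hx y hy hxy

open scoped Classical in
theorem IsListColoringOn.extend {A : Finset V} {f : V → β} (hf : IsListColoringOn G Λ A f) {v : V}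
    (hv : v ∉ A) (hcard : (A.filter (G.Adj v)).card < (Λ v).card) :
    ∃ f', (∀ x ∈ A, f' x = f x) ∧ IsListColoringOn G Λ (insert v A) f' := by
  obtain ⟨z, hz, hzf⟩ := Finset.exists_mem_notMem_of_card_lt_card
    ((Finset.card_image_le (s := A.filter (G.Adj v)) (f := f)).trans_lt hcard)
  refine ⟨_, hf.update hv hz fun y hy hvy h => hzf ?_⟩
  exact Finset.mem_image.2 ⟨y, Finset.mem_filter.2 ⟨hy, hvy⟩, h⟩

open scoped Classical in
/-- A vertex can be colored last if a color on one of its neighbors is repeated or outside its list. -/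
theorem IsListColoringOn.extend_of_repeated {A X : Finset V} {f : V → β}
    (hf : IsListColoringOn G Λ A f) (hA : A ⊆ X) {v z : V} (hv : v ∉ A)
    (hdeg : (X.filter (G.Adj v)).card ≤ (Λ v).card) (hz : z ∈ A) (hvz : G.Adj v z)
    (h : f z ∉ Λ v ∨ ∃ e ∈ A, e ≠ z ∧ G.Adj v e ∧ f z = f e) :
    ∃ f', (∀ x ∈ A, f' x = f x) ∧ IsListColoringOn G Λ (insert v A) f' := by
  have hzm : z ∈ A.filter (G.Adj v) := Finset.mem_filter.2 ⟨hz, hvz⟩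
  have h1 : ((A.filter (G.Adj v)).erase z).card < (Λ v).card := by
    have h2 := Finset.card_le_card (Finset.filter_subset_filter (G.Adj v) hA)
    have h3 : 0 < (A.filter (G.Adj v)).card := Finset.card_pos.2 ⟨z, hzm⟩
    rw [Finset.card_erase_of_mem hzm]
    omega
  obtain ⟨t, ht, htf⟩ := Finset.exists_mem_notMem_of_card_lt_card
    ((Finset.card_image_le (s := (A.filter (G.Adj v)).erase z) (f := f)).trans_lt h1)
  refine ⟨_, hf.update hv ht fun y hy hvy hyt => htf ?_⟩
  rw [Finset.mem_image]
  by_cases hyz : y = z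
  · subst hyz
    rcases h with h | ⟨e, he, hey, hve, h⟩
    · exact absurd (hyt ▸ ht) h
    · exact ⟨e, Finset.mem_erase.2 ⟨hey, Finset.mem_filter.2 ⟨he, hve⟩⟩, h ▸ hyt⟩
  · exact ⟨y, Finset.mem_erase.2 ⟨hyz, Finset.mem_filter.2 ⟨hy, hvy⟩⟩, hyt⟩

open scoped Classical in
/-- Greedy extension of a list coloring, in a degeneracy order of the new vertices. -/
theorem IsListColoringOn.extend_of_degenerate {A : Finset V} {f : V → β}
    (hf : IsListColoringOn G Λ A f) (X : Finset V) (hX : Disjoint A X)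
    (h : ∀ Y ⊆ X, Y.Nonempty → ∃ x ∈ Y, ((A ∪ Y).filter (G.Adj x)).card < (Λ x).card) :
    ∃ f', (∀ x ∈ A, f' x = f x) ∧ IsListColoringOn G Λ (A ∪ X) f' := by
  induction hn : X.card generalizing X with
  | zero =>
    rw [Finset.card_eq_zero] at hn
    subst hn
    exact ⟨f, fun _ _ => rfl, by simpa using hf⟩
  | succ n ih =>
    obtain ⟨x, hx, hcard⟩ := h X subset_rfl (by rw [← Finset.card_pos]; omega)
    obtain ⟨f', hf', hcol⟩ := ih (X.erase x)
      (Finset.disjoint_of_subset_right (Finset.erase_subset _ _) hX)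
      (fun Y hY => h Y (hY.trans (Finset.erase_subset _ _)))
      (by rw [Finset.card_erase_of_mem hx]; omega)
    have hxA : x ∉ A := fun hxA => Finset.disjoint_left.1 hX hxA hx
    obtain ⟨f'', hf'', hcol'⟩ := hcol.extend (v := x) (by simp [hxA])
      ((Finset.card_le_card (Finset.filter_subset_filter _
        (Finset.union_subset_union_right (Finset.erase_subset _ _)))).trans_lt hcard)
    refine ⟨f'', fun y hy => ?_, hcol'.mono ?_⟩
    · rw [hf'' y (Finset.mem_union_left _ hy), hf' y hy]
    · intro y hy
      simp only [Finset.mem_union, Finset.mem_insert, Finset.mem_erase] at hy ⊢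
      tauto

open scoped Classical in
/-- Coloring the vertices of a path in turn, towards an uncolored vertex. -/
theorem IsListColoringOn.extend_path {X : Finset V}
    (hdeg : ∀ x ∈ X, (X.filter (G.Adj x)).card ≤ (Λ x).card) (v : V) (hv : v ∈ X) (t : List V)
    {A : Finset V} {f : V → β} (hf : IsListColoringOn G Λ A f) (hA : A ⊆ X) (hvA : v ∉ A)
    (hchain : (t ++ [v]).IsChain G.Adj) (hnodup : (t ++ [v]).Nodup) (htX : ∀ x ∈ t, x ∈ X)
    (htA : ∀ x ∈ t, x ∉ A) :
    ∃ f', (∀ x ∈ A, f' x = f x) ∧ IsListColoringOn G Λ (A ∪ t.toFinset) f' := by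
  induction t generalizing A f with
  | nil => exact ⟨f, fun _ _ => rfl, by simpa using hf⟩
  | cons x t ih =>
    -- The next vertex of the path is still uncolored, so `x` has fewer colored neighbors than list
    -- colors.
    obtain ⟨y, hy, hyX, hxy⟩ : ∃ y, y ∉ A ∧ y ∈ X ∧ G.Adj x y := by
      cases t with
      | nil => exact ⟨v, hvA, hv, by simpa using hchain⟩
      | cons y t =>
        refine ⟨y, htA y (by simp), htX y (by simp), ?_⟩
        simp only [List.cons_append, List.isChain_cons_cons] at hchain
        exact hchain.1
    have hxX := htX x (by simp)
    have hxA := htA x (by simp)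
    have hlt : (A.filter (G.Adj x)).card < (Λ x).card := by
      refine lt_of_lt_of_le (Finset.card_lt_card ?_) (hdeg x hxX)
      refine Finset.ssubset_iff_of_subset (Finset.filter_subset_filter _ hA) |>.2
        ⟨y, Finset.mem_filter.2 ⟨hyX, hxy⟩, fun h => hy (Finset.mem_filter.1 h).1⟩
    obtain ⟨f', hf', hcol⟩ := hf.extend hxA hlt
    simp only [List.cons_append, List.nodup_cons, List.mem_append, List.mem_singleton] at hnodup
    obtain ⟨f'', hf'', hcol'⟩ := ih hcol (Finset.insert_subset hxX hA)
      (by simp only [Finset.mem_insert]; rintro (rfl | h); exacts [hnodup.1 (Or.inr rfl), hvA h])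
      (List.IsChain.of_cons hchain) hnodup.2 (fun z hz => htX z (by simp [hz]))
      (fun z hz => by
        simp only [Finset.mem_insert]
        rintro (rfl | h)
        exacts [hnodup.1 (Or.inl hz), htA z (by simp [hz]) h])
    refine ⟨f'', fun z hz => ?_, hcol'.mono ?_⟩
    · rw [hf'' z (Finset.mem_insert_of_mem hz), hf' z hz]
    · intro z hz
      simp only [Finset.mem_union, Finset.mem_insert, List.toFinset_cons] at hz ⊢
      tauto

end ListColoring

/-! ### Brooks' theorem on a Hamiltonian cycle -/

section Cycle

variable {V : Type*} {β : Type*} {G : SimpleGraph V} {Λ : V → Finset β} {X : Finset V}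

/-- `x :: t` lists the elements of `X` in the order of a Hamiltonian cycle of `G` on `X`. -/
def IsCycleOn (G : SimpleGraph V) (X : Finset V) (x : V) (t : List V) : Prop :=
  (x :: (t ++ [x])).IsChain G.Adj ∧ (x :: t).Nodup ∧ ∀ y, y ∈ X ↔ y ∈ x :: t

theorem IsCycleOn.rotate {x y : V} {p q : List V} (h : IsCycleOn G X x (p ++ y :: q)) :
    IsCycleOn G X y (q ++ x :: p) := by
  obtain ⟨h1, h2, h3⟩ := h
  refine ⟨?_, ?_, fun z => ?_⟩
  · have h4 : ((x :: p) ++ y :: (q ++ [x])).IsChain G.Adj := by simpa using h1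
    rw [List.isChain_split] at h4
    have h5 : ((y :: q) ++ x :: (p ++ [y])).IsChain G.Adj := by
      rw [List.isChain_split]
      exact ⟨by simpa using h4.2, by simpa using h4.1⟩
    simpa using h5
  · have : ((x :: p) ++ (y :: q)).Nodup := by simpa using h2
    have h6 := (List.perm_append_comm (l₁ := x :: p) (l₂ := y :: q)).nodup_iff.1 this
    simpa using h6
  · rw [h3]
    simp only [List.mem_cons, List.mem_append]
    tauto

theorem IsCycleOn.exists_rotate {x y : V} {t : List V} (h : IsCycleOn G X x t) (hy : y ∈ X) :
    ∃ t', IsCycleOn G X y t' := by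
  rw [h.2.2, List.mem_cons] at hy
  rcases hy with rfl | hy
  · exact ⟨t, h⟩
  · obtain ⟨p, q, rfl⟩ := List.append_of_mem hy
    exact ⟨_, h.rotate⟩

theorem isListColoringOn_singleton [DecidableEq V] {x : V} {z : β} (hz : z ∈ Λ x) :
    IsListColoringOn G Λ {x} fun _ => z := by
  refine ⟨by simpa using hz, fun a ha b hb hab => ?_⟩
  rw [Finset.mem_singleton] at ha hb
  subst ha; subst hb
  exact absurd hab G.irrefl

theorem isChain_adj_reverse {l : List V} (h : l.IsChain G.Adj) : l.reverse.IsChain G.Adj := by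
  rw [List.isChain_reverse]
  exact h.imp fun _ _ hab => hab.symm

-- Give `x` a color missing from the list of `y`. Both arcs of the cycle are then colored towards
-- `y`, which keeps a free color because `x` blocks none.
open scoped Classical in
theorem IsCycleOn.exists_coloring_of_list_ne {x y : V} {t : List V} (h : IsCycleOn G X x t)
    (hdeg : ∀ x ∈ X, (X.filter (G.Adj x)).card ≤ (Λ x).card) (hy : y ∈ t) (hxy : G.Adj x y)
    (hΛ : ¬ Λ x ⊆ Λ y) : ∃ f, IsListColoringOn G Λ X f := by
  obtain ⟨p, q, rfl⟩ := List.append_of_mem hy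
  obtain ⟨h1, h2, h3⟩ := h
  obtain ⟨z, hzx, hzy⟩ := Finset.not_subset.1 hΛ
  have hX : ∀ v, v ∈ X ↔ v = x ∨ v ∈ p ∨ v = y ∨ v ∈ q := by
    intro v; rw [h3]; simp
  have hc : ((x :: p) ++ y :: (q ++ [x])).IsChain G.Adj := by simpa using h1
  rw [List.isChain_split] at hc
  have hcp : (p ++ [y]).IsChain G.Adj := List.IsChain.of_cons (by simpa using hc.1)
  have hcq : (q.reverse ++ [y]).IsChain G.Adj := by
    have : ((y :: q) ++ [x]).IsChain G.Adj := by simpa using hc.2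
    simpa using isChain_adj_reverse this.left_of_append
  simp only [List.nodup_cons, List.nodup_append, List.mem_append, List.mem_cons] at h2
  have hyX : y ∈ X := by rw [hX]; simp
  obtain ⟨f₁, hf₁, hcol₁⟩ := (isListColoringOn_singleton (G := G) hzx).extend_path hdeg y hyX p
    (by rw [Finset.singleton_subset_iff, hX]; simp) (by simpa using hxy.ne') hcp
    (by simp only [List.nodup_append, List.mem_singleton, List.nodup_singleton]; grind)
    (fun v hv => by rw [hX]; simp [hv])
    (fun v hv => by rw [Finset.mem_singleton]; grind)
  obtain ⟨f₂, hf₂, hcol₂⟩ := hcol₁.extend_path hdeg y hyX q.reverse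
    (fun v hv => by
      simp only [Finset.mem_union, Finset.mem_singleton, List.mem_toFinset] at hv
      rw [hX]; tauto)
    (by simp only [Finset.mem_union, Finset.mem_singleton, List.mem_toFinset]; grind) hcq
    (by simp only [List.nodup_append, List.mem_singleton, List.nodup_singleton, List.nodup_reverse,
          List.mem_reverse]; grind)
    (fun v hv => by rw [hX]; simp only [List.mem_reverse] at hv; simp [hv])
    (fun v hv => by
      simp only [List.mem_reverse] at hv
      simp only [Finset.mem_union, Finset.mem_singleton, List.mem_toFinset]; grind)
  obtain ⟨f₃, -, hcol₃⟩ := hcol₂.extend_of_repeated (X := X) (v := y) (z := x)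
    (fun v hv => by
      simp only [Finset.mem_union, Finset.mem_singleton, List.mem_toFinset, List.mem_reverse] at hv
      rw [hX]; tauto)
    (by simp only [Finset.mem_union, Finset.mem_singleton, List.mem_toFinset, List.mem_reverse]
        grind)
    (hdeg y hyX) (by simp) hxy.symm
    (Or.inl (by rw [hf₂ x (by simp), hf₁ x (by simp)]; exact hzy))
  refine ⟨f₃, hcol₃.mono fun v hv => ?_⟩
  rw [hX] at hv
  simp only [Finset.mem_insert, Finset.mem_union, Finset.mem_singleton, List.mem_toFinset,
    List.mem_reverse]
  tauto

-- The nonadjacent vertices `x` and `w` receive the same color, so `y`, colored last, sees a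
-- repetition. The stretch `q` is cut off from `y` along the cycle by `w` and `x`; it is colored
-- towards `y` through the chord from `s`.
open scoped Classical in
theorem IsCycleOn.exists_coloring_of_not_adj {x y w : V} {p q : List V} {T : Finset β}
    (h : IsCycleOn G X x (p ++ y :: w :: q)) (hT : T.Nonempty) (hΛ : ∀ v ∈ X, Λ v = T)
    (hdeg : ∀ x ∈ X, (X.filter (G.Adj x)).card ≤ (Λ x).card) (hxy : G.Adj x y)
    (hxw : ¬ G.Adj x w) (hq : q = [] ∨ ∃ s ∈ q, G.Adj s y) :
    ∃ f, IsListColoringOn G Λ X f := by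
  obtain ⟨h1, h2, h3⟩ := h
  obtain ⟨τ, hτ⟩ := hT
  have hX : ∀ v, v ∈ X ↔ v = x ∨ v ∈ p ∨ v = y ∨ v = w ∨ v ∈ q := by
    intro v; rw [h3]; simp
  have hc : ((x :: p) ++ y :: (w :: q ++ [x])).IsChain G.Adj := by simpa using h1
  rw [List.isChain_split] at hc
  have hcp : (p ++ [y]).IsChain G.Adj := List.IsChain.of_cons (by simpa using hc.1)
  have hyw : G.Adj y w := by
    have := hc.2
    simp only [List.cons_append, List.isChain_cons_cons] at this
    exact this.1
  have hcq : q.IsChain G.Adj := by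
    have : ((y :: w :: q) ++ [x]).IsChain G.Adj := by simpa using hc.2
    exact List.IsChain.of_cons (List.IsChain.of_cons this.left_of_append)
  simp only [List.nodup_cons, List.nodup_append, List.mem_append, List.mem_cons] at h2
  have hyX : y ∈ X := by rw [hX]; simp
  have hcol₀ : IsListColoringOn G Λ {x, w} fun _ => τ := by
    refine ⟨fun v hv => ?_, fun a ha b hb hab => ?_⟩
    · rw [hΛ v]
      · exact hτ
      · simp only [Finset.mem_insert, Finset.mem_singleton] at hv
        rw [hX]; tauto
    · simp only [Finset.mem_insert, Finset.mem_singleton] at ha hb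
      rcases ha with rfl | rfl <;> rcases hb with rfl | rfl
      · exact absurd hab G.irrefl
      · exact absurd hab hxw
      · exact absurd hab.symm hxw
      · exact absurd hab G.irrefl
  have hA₀ : ({x, w} : Finset V) ⊆ X := by
    intro v hv
    simp only [Finset.mem_insert, Finset.mem_singleton] at hv
    rw [hX]; tauto
  obtain ⟨f₁, hf₁, hcol₁⟩ : ∃ f, (∀ v ∈ ({x, w} : Finset V), f v = τ) ∧
      IsListColoringOn G Λ ({x, w} ∪ q.toFinset) f := by
    rcases hq with rfl | ⟨s, hs, hsy⟩
    · exact ⟨_, fun _ _ => rfl, by simpa using hcol₀⟩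
    · obtain ⟨q₁, q₂, rfl⟩ := List.append_of_mem hs
      simp only [List.nodup_cons, List.nodup_append, List.mem_append, List.mem_cons] at h2
      rw [List.isChain_split] at hcq
      obtain ⟨f₁, hf₁, hcol₁⟩ := hcol₀.extend_path hdeg s (by rw [hX]; simp) q₂.reverse hA₀
        (by simp only [Finset.mem_insert, Finset.mem_singleton]; grind)
        (by simpa using isChain_adj_reverse hcq.2)
        (by simp only [List.nodup_append, List.mem_singleton, List.nodup_singleton,
              List.nodup_reverse, List.mem_reverse]; grind)
        (fun v hv => by rw [hX]; simp only [List.mem_reverse] at hv; simp [hv])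
        (fun v hv => by
          simp only [List.mem_reverse] at hv
          simp only [Finset.mem_insert, Finset.mem_singleton]; grind)
      obtain ⟨f₂, hf₂, hcol₂⟩ := hcol₁.extend_path hdeg y hyX (q₁ ++ [s])
        (Finset.union_subset hA₀ fun v hv => by
          simp only [List.mem_toFinset, List.mem_reverse] at hv
          rw [hX]; simp [hv])
        (by simp only [Finset.mem_union, Finset.mem_insert, Finset.mem_singleton, List.mem_toFinset,
              List.mem_reverse]; grind)
        (by
          have : (q₁ ++ s :: [y]).IsChain G.Adj := by
            rw [List.isChain_split]
            exact ⟨hcq.1, by simpa using hsy⟩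
          simpa using this)
        (by simp only [List.nodup_append, List.mem_singleton, List.nodup_singleton,
              List.mem_append]; grind)
        (fun v hv => by
          simp only [List.mem_append, List.mem_singleton] at hv
          rw [hX]; simp only [List.mem_append, List.mem_cons]; tauto)
        (fun v hv => by
          simp only [List.mem_append, List.mem_singleton] at hv
          simp only [Finset.mem_union, Finset.mem_insert, Finset.mem_singleton, List.mem_toFinset,
              List.mem_reverse]; grind)
      refine ⟨f₂, fun v hv => ?_, hcol₂.mono fun v hv => ?_⟩
      · rw [hf₂ v (Finset.mem_union_left _ hv), hf₁ v hv]
      · simp only [Finset.mem_union, List.mem_toFinset, List.mem_append, List.mem_cons,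
          List.mem_reverse] at hv ⊢
        tauto
  obtain ⟨f₂, hf₂, hcol₂⟩ := hcol₁.extend_path hdeg y hyX p
    (Finset.union_subset hA₀ fun v hv => by
      rw [List.mem_toFinset] at hv
      rw [hX]; simp [hv])
    (by simp only [Finset.mem_union, Finset.mem_insert, Finset.mem_singleton, List.mem_toFinset]
        grind) hcp
    (by simp only [List.nodup_append, List.mem_singleton, List.nodup_singleton]; grind)
    (fun v hv => by rw [hX]; simp [hv])
    (fun v hv => by
      simp only [Finset.mem_union, Finset.mem_insert, Finset.mem_singleton, List.mem_toFinset]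
      grind)
  obtain ⟨f₃, -, hcol₃⟩ := hcol₂.extend_of_repeated (X := X) (v := y) (z := x)
    (fun v hv => by
      simp only [Finset.mem_union, Finset.mem_insert, Finset.mem_singleton,
        List.mem_toFinset] at hv
      rw [hX]; tauto)
    (by simp only [Finset.mem_union, Finset.mem_insert, Finset.mem_singleton, List.mem_toFinset]
        grind)
    (hdeg y hyX) (by simp) hxy.symm
    (Or.inr ⟨w, by simp, by grind, hyw, by
      rw [hf₂ x (by simp), hf₁ x (by simp), hf₂ w (by simp), hf₁ w (by simp)]⟩)
  refine ⟨f₃, hcol₃.mono fun v hv => ?_⟩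
  rw [hX] at hv
  simp only [Finset.mem_insert, Finset.mem_union, Finset.mem_singleton, List.mem_toFinset]
  tauto

/-- A list with an element satisfying `P` splits at its first such element. -/
theorem exists_eq_append_cons_of_first (P : V → Prop) (t : List V) (h : ∃ x ∈ t, P x) :
    ∃ p w q, t = p ++ w :: q ∧ P w ∧ ∀ x ∈ p, ¬ P x := by
  induction t with
  | nil => simp at h
  | cons a t ih =>
    by_cases ha : P a
    · exact ⟨[], a, t, rfl, ha, by simp⟩
    · obtain ⟨p, w, q, rfl, hw, hp⟩ := ih (by simpa [ha] using h)
      exact ⟨a :: p, w, q, rfl, hw, by simpa [ha] using hp⟩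

open scoped Classical in
theorem IsCycleOn.exists_coloring_or_clique {k : ℕ} (hk : 3 ≤ k) {x : V} {t : List V}
    (h : IsCycleOn G X x t) (hΛ : ∀ v ∈ X, (Λ v).card = k)
    (hdeg : ∀ v ∈ X, (X.filter (G.Adj v)).card = k)
    (hconn : ∀ Y ⊆ X, Y.Nonempty → Y ≠ X → ∃ x ∈ Y, ∃ y ∈ X, y ∉ Y ∧ G.Adj x y) :
    (∃ f, IsListColoringOn G Λ X f) ∨
      (X.card = k + 1 ∧ (∀ x ∈ X, ∀ y ∈ X, x ≠ y → G.Adj x y) ∧ ∃ T, ∀ x ∈ X, Λ x = T) := by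
  have hdeg' : ∀ v ∈ X, (X.filter (G.Adj v)).card ≤ (Λ v).card := fun v hv => by
    rw [hΛ v hv, hdeg v hv]
  have hxX : x ∈ X := by rw [h.2.2]; simp
  by_cases hconst : ∀ v ∈ X, Λ v = Λ x
  swap
  · left
    -- If the lists are not all equal, connectedness gives an edge whose ends have different lists.
    obtain ⟨a, ha, b, hb, hbZ, hab⟩ := hconn (X.filter fun v => Λ v = Λ x) (Finset.filter_subset _ _)
      ⟨x, Finset.mem_filter.2 ⟨hxX, rfl⟩⟩ fun h' => hconst (Finset.filter_eq_self.1 h')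
    rw [Finset.mem_filter] at ha hbZ
    obtain ⟨t', ht'⟩ := h.exists_rotate ha.1
    refine ht'.exists_coloring_of_list_ne hdeg' ?_ hab fun hsub => ?_
    · rw [ht'.2.2, List.mem_cons] at hb
      exact hb.resolve_left hab.ne'
    · have := Finset.eq_of_subset_of_card_le hsub (by rw [hΛ a ha.1, hΛ b hb])
      exact hbZ ⟨hb, this ▸ ha.2⟩
  by_cases hcl : ∀ x ∈ X, ∀ y ∈ X, x ≠ y → G.Adj x y
  · right
    refine ⟨?_, hcl, _, hconst⟩
    have : X.filter (G.Adj x) = X.erase x := by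
      ext y
      simp only [Finset.mem_filter, Finset.mem_erase]
      exact ⟨fun hy => ⟨hy.2.ne', hy.1⟩, fun hy => ⟨hy.2, hcl x hxX y hy.2 hy.1.symm⟩⟩
    have h1 := hdeg x hxX
    rw [this, Finset.card_erase_of_mem hxX] at h1
    omega
  left
  have hTne : (Λ x).Nonempty := by rw [← Finset.card_pos, hΛ x hxX]; omega
  by_cases htri : ∃ a b c q, IsCycleOn G X a (b :: c :: q) ∧ ¬ G.Adj a c
  · obtain ⟨a, b, c, q, hcyc, hac⟩ := htri
    have hb : b ∈ X := by rw [hcyc.2.2]; simp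
    have hch := hcyc.1
    simp only [List.cons_append, List.isChain_cons_cons] at hch
    refine IsCycleOn.exists_coloring_of_not_adj (p := []) hcyc hTne hconst hdeg' hch.1 hac
      (Or.inr ?_)
    -- As `k ≥ 3`, the vertex `b` has a neighbor besides its cycle neighbors `a` and `c`.
    by_contra hno
    push Not at hno
    have hsub : X.filter (G.Adj b) ⊆ {a, c} := by
      intro s hs
      rw [Finset.mem_filter, hcyc.2.2] at hs
      simp only [List.mem_cons] at hs
      simp only [Finset.mem_insert, Finset.mem_singleton]
      rcases hs with ⟨rfl | rfl | rfl | hsq, hbs⟩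
      · exact Or.inl rfl
      · exact absurd hbs G.irrefl
      · exact Or.inr rfl
      · exact absurd hbs.symm (hno s hsq)
    have h1 := (Finset.card_le_card hsub).trans Finset.card_le_two
    rw [hdeg b hb] at h1
    omega
  -- Now vertices at distance two on the cycle are adjacent. With `w` the first non-neighbor of `a`
  -- and `y` its predecessor, the vertex after `w` supplies the required chord to `y`.
  · push Not at hcl htri
    obtain ⟨a, ha, b, hb, hab, hnadj⟩ := hcl
    obtain ⟨t', ht'⟩ := h.exists_rotate ha
    rw [ht'.2.2, List.mem_cons] at hb
    obtain ⟨p, w, q, rfl, hw, hp⟩ := exists_eq_append_cons_of_first (fun v => ¬ G.Adj a v) t'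
      ⟨b, hb.resolve_left hab.symm, hnadj⟩
    rcases List.eq_nil_or_concat p with rfl | ⟨p, y, rfl⟩
    · have hch := ht'.1
      simp only [List.nil_append, List.cons_append, List.isChain_cons_cons] at hch
      exact absurd hch.1 hw
    · have hay : G.Adj a y := not_not.1 (hp y (by simp))
      have hcyc : IsCycleOn G X a (p ++ y :: w :: q) := by simpa using ht'
      refine hcyc.exists_coloring_of_not_adj hTne hconst hdeg' hay hw ?_
      cases q with
      | nil => exact Or.inl rfl
      | cons s q => exact Or.inr ⟨s, by simp, (htri _ _ _ _ hcyc.rotate).symm⟩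

end Cycle

/-! ### Brooks' theorem for lists of constant size -/

section Brooks

variable {V : Type*} {β : Type*} {G : SimpleGraph V} {Λ : V → Finset β} {X : Finset V}

open scoped Classical in
/-- There is a path in `X` whose first vertex has all its neighbors on the path, and which cannot be
replaced by a longer path in `X`. -/
theorem exists_longest_path (G : SimpleGraph V) (hX : X.Nonempty) :
    ∃ e t, (e :: t).IsChain G.Adj ∧ (e :: t).Nodup ∧ (∀ x ∈ e :: t, x ∈ X) ∧
      ∀ l : List V, l.IsChain G.Adj → l.Nodup → (∀ x ∈ l, x ∈ X) → l.length ≤ (e :: t).length := by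
  let Q : ℕ → Prop := fun n => ∃ l : List V, l.length = n ∧ l.IsChain G.Adj ∧ l.Nodup ∧ ∀ x ∈ l, x ∈ X
  have hbound : ∀ l : List V, l.Nodup → (∀ x ∈ l, x ∈ X) → l.length ≤ X.card := by
    intro l hl hlX
    rw [← List.toFinset_card_of_nodup hl]
    exact Finset.card_le_card fun x hx => hlX x (List.mem_toFinset.1 hx)
  obtain ⟨x, hx⟩ := hX
  have h1 : Q 1 := ⟨[x], rfl, by simp, by simp, by simpa using hx⟩
  have hpos : 1 ≤ X.card := Finset.card_pos.2 ⟨x, hx⟩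
  obtain ⟨l, hlen, hc, hn, hlX⟩ := Nat.findGreatest_spec (P := Q) hpos h1
  have hge : 1 ≤ l.length := hlen ▸ Nat.le_findGreatest hpos h1
  cases l with
  | nil => simp at hge
  | cons e t =>
    refine ⟨e, t, hc, hn, hlX, fun l' hc' hn' hl' => ?_⟩
    rw [hlen]
    exact Nat.le_findGreatest (hbound l' hn' hl') ⟨l', rfl, hc', hn', hl'⟩

theorem exists_eq_append_cons_of_last (P : V → Prop) (t : List V) (h : ∃ x ∈ t, P x) :
    ∃ p w q, t = p ++ w :: q ∧ P w ∧ ∀ x ∈ q, ¬ P x := by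
  obtain ⟨p, w, q, h1, h2, h3⟩ := exists_eq_append_cons_of_first P t.reverse (by simpa using h)
  refine ⟨q.reverse, w, p.reverse, ?_, h2, by simpa using h3⟩
  rw [← List.reverse_reverse t, h1]
  simp

-- All neighbors of the end `e` of a longest path lie on the path; let `v` be the last of them. If
-- `v` is the other end, the path closes to a cycle, which is Hamiltonian by maximality and
-- connectedness. Otherwise `e` and the successor `z` of `v` are nonadjacent neighbors of `v`, and
-- `v` is colored last.
open scoped Classical in
theorem exists_coloring_or_clique_of_connected {k : ℕ} (hk : 3 ≤ k)
    (hΛ : ∀ v ∈ X, (Λ v).card = k) (hdeg : ∀ v ∈ X, (X.filter (G.Adj v)).card = k)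
    (hconn : ∀ Y ⊆ X, Y.Nonempty → Y ≠ X → ∃ x ∈ Y, ∃ y ∈ X, y ∉ Y ∧ G.Adj x y)
    (hX : X.Nonempty) :
    (∃ f, IsListColoringOn G Λ X f) ∨
      (X.card = k + 1 ∧ (∀ x ∈ X, ∀ y ∈ X, x ≠ y → G.Adj x y) ∧ ∃ T, ∀ x ∈ X, Λ x = T) := by
  have hdeg' : ∀ v ∈ X, (X.filter (G.Adj v)).card ≤ (Λ v).card := fun v hv => by
    rw [hΛ v hv, hdeg v hv]
  obtain ⟨e, t, hc, hn, hlX, hmax⟩ := exists_longest_path G hX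
  have heX : e ∈ X := hlX e (by simp)
  have hend : ∀ y ∈ X, G.Adj e y → y ∈ t := by
    intro y hy hey
    by_contra hyt
    have hye : y ≠ e := hey.ne'
    have := hmax (y :: e :: t) (by rw [List.isChain_cons_cons]; exact ⟨hey.symm, hc⟩)
      (List.nodup_cons.2 ⟨by simp [hye, hyt], hn⟩)
      (fun x hx => by
        rw [List.mem_cons] at hx
        rcases hx with rfl | hx
        exacts [hy, hlX x hx])
    simp at this
  obtain ⟨y₀, hy₀⟩ : (X.filter (G.Adj e)).Nonempty := by
    rw [← Finset.card_pos, hdeg e heX]; omega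
  rw [Finset.mem_filter] at hy₀
  obtain ⟨p, v, q, rfl, hev, hq⟩ := exists_eq_append_cons_of_last (G.Adj e) t
    ⟨y₀, hend y₀ hy₀.1 hy₀.2, hy₀.2⟩
  cases q with
  | nil =>
    have hcycle : (e :: (p ++ [v])).IsChain G.Adj := hc
    have hchain : (e :: ((p ++ [v]) ++ [e])).IsChain G.Adj := by
      have : ((e :: p) ++ v :: [e]).IsChain G.Adj := by
        rw [List.isChain_split]
        exact ⟨by simpa using hcycle, by simpa using hev.symm⟩
      simpa using this
    have hset : ∀ y, y ∈ X ↔ y ∈ e :: (p ++ [v]) := by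
      intro y
      refine ⟨fun hy => ?_, fun hy => hlX y hy⟩
      by_contra hyl
      -- An edge leaving the cycle, followed by the cycle cut open at its end, would be a longer
      -- path.
      obtain ⟨a, ha, b, hb, hba, hab⟩ := hconn (e :: (p ++ [v])).toFinset
        (fun z hz => hlX z (List.mem_toFinset.1 hz)) ⟨e, by simp⟩
        (fun h' => hyl (List.mem_toFinset.1 (h' ▸ hy)))
      rw [List.mem_toFinset] at ha hba
      have hcyc : IsCycleOn G (e :: (p ++ [v])).toFinset e (p ++ [v]) :=
        ⟨hchain, hn, fun z => List.mem_toFinset⟩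
      obtain ⟨t', ht'⟩ := hcyc.exists_rotate (List.mem_toFinset.2 ha)
      have hmem : ∀ z, z ∈ a :: t' ↔ z ∈ e :: (p ++ [v]) := fun z => by
        rw [← ht'.2.2, List.mem_toFinset]
      have hlen : (a :: t').length = (e :: (p ++ [v])).length := by
        rw [← List.toFinset_card_of_nodup ht'.2.1, ← List.toFinset_card_of_nodup hn]
        congr 1
        ext z
        rw [List.mem_toFinset, List.mem_toFinset, hmem]
      have hat : (a :: t').IsChain G.Adj := by
        have : ((a :: t') ++ [a]).IsChain G.Adj := by simpa using ht'.1
        exact this.left_of_append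
      have := hmax (b :: a :: t') (by rw [List.isChain_cons_cons]; exact ⟨hab.symm, hat⟩)
        (List.nodup_cons.2 ⟨fun h => hba ((hmem b).1 h), ht'.2.1⟩)
        (fun x hx => by
          rw [List.mem_cons] at hx
          rcases hx with rfl | hx
          exacts [hb, hlX x ((hmem x).1 hx)])
      rw [List.length_cons, hlen] at this
      omega
    exact IsCycleOn.exists_coloring_or_clique hk ⟨hchain, hn, hset⟩ hΛ hdeg hconn
  | cons z q =>
    left
    have hez : ¬ G.Adj e z := hq z (by simp)
    have hchain : ((e :: p) ++ v :: z :: q).IsChain G.Adj := by simpa using hc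
    rw [List.isChain_split] at hchain
    have hpv : (p ++ [v]).IsChain G.Adj := List.IsChain.of_cons (by simpa using hchain.1)
    have hvz : G.Adj v z := by
      have := hchain.2
      rw [List.isChain_cons_cons] at this
      exact this.1
    simp only [List.nodup_cons, List.nodup_append, List.mem_append, List.mem_cons] at hn
    simp only [List.mem_append, List.mem_cons] at hend hlX
    have hvX : v ∈ X := hlX v (by simp)
    have hzX : z ∈ X := hlX z (by simp)
    have hpX : ∀ x ∈ p, x ∈ X := fun x hx => hlX x (by simp [hx])
    let C : Finset V := insert e (insert v p.toFinset)
    have hC : ∀ x, x ∈ C ↔ x = e ∨ x = v ∨ x ∈ p := by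
      intro x; simp [C]
    have hnbr : ∀ y ∈ X, G.Adj e y → y ∈ C := by
      intro y hy hey
      rw [hC]
      rcases hend y hy hey with h | h | h | h
      · exact Or.inr (Or.inr h)
      · exact Or.inr (Or.inl h)
      · exact absurd (h ▸ hey) hez
      · exact absurd hey (hq y (by simp [h]))
    have hzC : z ∉ C := by rw [hC]; grind
    -- Every nonempty part of `X \ C` has an edge leaving it, so greedy coloring works outside `C`.
    obtain ⟨f₀, hcol₀⟩ : ∃ f, IsListColoringOn G Λ (X \ C) f := by
      obtain ⟨c, hc⟩ : (Λ e).Nonempty := by rw [← Finset.card_pos, hΛ e heX]; omega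
      have hempty : IsListColoringOn G Λ ∅ fun _ => c := ⟨by simp, by simp⟩
      obtain ⟨f, -, hf⟩ := hempty.extend_of_degenerate (X \ C) (Finset.disjoint_empty_left _) (by
        intro Y hY hYne
        obtain ⟨x, hx, y, hy, hyY, hxy⟩ := hconn Y (hY.trans Finset.sdiff_subset) hYne (by
          rintro rfl
          exact (Finset.mem_sdiff.1 (hY heX)).2 ((hC e).2 (Or.inl rfl)))
        have hxX := (Finset.mem_sdiff.1 (hY hx)).1
        refine ⟨x, hx, ?_⟩
        rw [Finset.empty_union]
        refine lt_of_lt_of_le (Finset.card_lt_card ?_) (hdeg' x hxX)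
        exact (Finset.ssubset_iff_of_subset (Finset.filter_subset_filter _
          (hY.trans Finset.sdiff_subset))).2 ⟨y, Finset.mem_filter.2 ⟨hy, hxy⟩,
            fun h => hyY (Finset.mem_filter.1 h).1⟩)
      exact ⟨f, by simpa using hf⟩
    have hzA : z ∈ X \ C := Finset.mem_sdiff.2 ⟨hzX, hzC⟩
    have heA : e ∉ X \ C := fun h => (Finset.mem_sdiff.1 h).2 ((hC e).2 (Or.inl rfl))
    -- The color of `e` is unconstrained, as `e` has no neighbor outside `C`. It is chosen so that
    -- `e` and `z` together block at most one color of `v`.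
    obtain ⟨τ, hτ, hgood⟩ : ∃ τ ∈ Λ e, f₀ z ∉ Λ v ∨ τ ∉ Λ v ∨ τ = f₀ z := by
      by_cases h1 : f₀ z ∈ Λ v
      · by_cases h2 : f₀ z ∈ Λ e
        · exact ⟨_, h2, Or.inr (Or.inr rfl)⟩
        · have : ¬ Λ e ⊆ Λ v := fun h => h2 <| by
            rw [Finset.eq_of_subset_of_card_le h (by rw [hΛ e heX, hΛ v hvX])]
            exact h1
          obtain ⟨τ, h3, h4⟩ := Finset.not_subset.1 this
          exact ⟨τ, h3, Or.inr (Or.inl h4)⟩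
      · obtain ⟨τ, hτ⟩ : (Λ e).Nonempty := by rw [← Finset.card_pos, hΛ e heX]; omega
        exact ⟨τ, hτ, Or.inl h1⟩
    obtain ⟨hf₁, hcol₁⟩ := hcol₀.update heA hτ fun y hy hey =>
      absurd (hnbr y (Finset.mem_sdiff.1 hy).1 hey) (Finset.mem_sdiff.1 hy).2
    have hA₁ : insert e (X \ C) ⊆ X := Finset.insert_subset heX Finset.sdiff_subset
    have hmemC : ∀ x, x ≠ e → x ∈ C → x ∉ insert e (X \ C) := by
      intro x hxe hxC h
      rw [Finset.mem_insert, Finset.mem_sdiff] at h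
      exact h.elim hxe fun h => h.2 hxC
    have hve : v ≠ e := hev.ne'
    obtain ⟨f₂, hf₂, hcol₂⟩ := hcol₁.extend_path hdeg' v hvX p hA₁
      (hmemC v hve ((hC v).2 (Or.inr (Or.inl rfl)))) hpv
      (by simp only [List.nodup_append, List.mem_singleton, List.nodup_singleton]; grind) hpX
      (fun x hx => hmemC x (by rintro rfl; exact hn.1 (Or.inl hx)) ((hC x).2 (Or.inr (Or.inr hx))))
    have hvA₂ : v ∉ insert e (X \ C) ∪ p.toFinset := by
      rw [Finset.mem_union, List.mem_toFinset, not_or]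
      exact ⟨hmemC v hve ((hC v).2 (Or.inr (Or.inl rfl))), by grind⟩
    have hA₂ : insert e (X \ C) ∪ p.toFinset ⊆ X :=
      Finset.union_subset hA₁ fun x hx => hpX x (List.mem_toFinset.1 hx)
    have hfz : f₂ z = f₀ z := by
      rw [hf₂ z (Finset.mem_insert_of_mem hzA), hf₁ z hzA]
    have hfe : f₂ e = τ := by
      rw [hf₂ e (Finset.mem_insert_self _ _), Function.update_self]
    have heA₂ : e ∈ insert e (X \ C) ∪ p.toFinset := by simp
    have hzA₂ : z ∈ insert e (X \ C) ∪ p.toFinset :=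
      Finset.mem_union_left _ (Finset.mem_insert_of_mem hzA)
    have hze : z ≠ e := by rintro rfl; exact heA hzA
    obtain ⟨f₃, -, hcol₃⟩ : ∃ f', (∀ x ∈ insert e (X \ C) ∪ p.toFinset, f' x = f₂ x) ∧
        IsListColoringOn G Λ (insert v (insert e (X \ C) ∪ p.toFinset)) f' := by
      rcases hgood with h | h | h
      · exact hcol₂.extend_of_repeated hA₂ hvA₂ (hdeg' v hvX) hzA₂ hvz (Or.inl (by rwa [hfz]))
      · exact hcol₂.extend_of_repeated hA₂ hvA₂ (hdeg' v hvX) heA₂ hev.symm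
          (Or.inl (by rwa [hfe]))
      · exact hcol₂.extend_of_repeated hA₂ hvA₂ (hdeg' v hvX) heA₂ hev.symm
          (Or.inr ⟨z, hzA₂, hze, hvz, by rw [hfe, hfz, h]⟩)
    refine ⟨f₃, hcol₃.mono fun x hx => ?_⟩
    simp only [Finset.mem_insert, Finset.mem_union, Finset.mem_sdiff, List.mem_toFinset, hC, hx,
      true_and]
    tauto

open scoped Classical in
/-- Brooks' theorem for list colorings, with lists of a constant size `k ≥ 3`. -/
theorem exists_listColoring_or_clique {k : ℕ} (hk : 3 ≤ k) (X : Finset V)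
    (hΛ : ∀ v ∈ X, (Λ v).card = k) (hdeg : ∀ v ∈ X, (X.filter (G.Adj v)).card ≤ k)
    (hβ : Nonempty β) :
    (∃ f, IsListColoringOn G Λ X f) ∨ ∃ Q ⊆ X, Q.card = k + 1 ∧
      (∀ x ∈ Q, ∀ y ∈ Q, x ≠ y → G.Adj x y) ∧ ∃ T, ∀ x ∈ Q, Λ x = T := by
  induction hn : X.card using Nat.strong_induction_on generalizing X with
  | _ n ih =>
    subst hn
    rcases X.eq_empty_or_nonempty with rfl | hX
    · exact Or.inl ⟨fun _ => hβ.some, by simp, by simp⟩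
    have hsub : ∀ Y ⊆ X, Y ≠ X → (∃ f, IsListColoringOn G Λ Y f) ∨ ∃ Q ⊆ X, Q.card = k + 1 ∧
        (∀ x ∈ Q, ∀ y ∈ Q, x ≠ y → G.Adj x y) ∧ ∃ T, ∀ x ∈ Q, Λ x = T := by
      intro Y hY hYX
      rcases ih Y.card (Finset.card_lt_card (hY.ssubset_of_ne hYX)) Y (fun v hv => hΛ v (hY hv))
        (fun v hv => (Finset.card_le_card (Finset.filter_subset_filter _ hY)).trans
          (hdeg v (hY hv))) rfl with h | ⟨Q, hQ, h⟩
      · exact Or.inl h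
      · exact Or.inr ⟨Q, hQ.trans hY, h⟩
    -- A connected non-regular `X` is degenerate thanks to a vertex of degree below `k`; a
    -- disconnected `X` splits into two smaller sets.
    by_cases hconn : ∀ Y ⊆ X, Y.Nonempty → Y ≠ X → ∃ x ∈ Y, ∃ y ∈ X, y ∉ Y ∧ G.Adj x y
    · by_cases hreg : ∀ v ∈ X, (X.filter (G.Adj v)).card = k
      · rcases exists_coloring_or_clique_of_connected hk hΛ hreg hconn hX with h | h
        · exact Or.inl h
        · exact Or.inr ⟨X, subset_rfl, h⟩
      · left
        push Not at hreg
        obtain ⟨v, hv, hvk⟩ := hreg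
        have hempty : IsListColoringOn G Λ ∅ fun _ => hβ.some := ⟨by simp, by simp⟩
        obtain ⟨f, -, hf⟩ := hempty.extend_of_degenerate X (Finset.disjoint_empty_left _) (by
          intro Y hY hYne
          rw [Finset.empty_union]
          by_cases hYX : Y = X
          · subst hYX
            exact ⟨v, hv, by rw [hΛ v hv]; exact lt_of_le_of_ne (hdeg v hv) hvk⟩
          · obtain ⟨x, hx, y, hy, hyY, hxy⟩ := hconn Y hY hYne hYX
            refine ⟨x, hx, ?_⟩
            rw [hΛ x (hY hx)]
            refine lt_of_lt_of_le (Finset.card_lt_card ?_) (hdeg x (hY hx))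
            exact (Finset.ssubset_iff_of_subset (Finset.filter_subset_filter _ hY)).2
              ⟨y, Finset.mem_filter.2 ⟨hy, hxy⟩, fun h => hyY (Finset.mem_filter.1 h).1⟩)
        exact ⟨f, by simpa using hf⟩
    · push Not at hconn
      obtain ⟨Y, hY, hYne, hYX, hno⟩ := hconn
      rcases hsub Y hY hYX with ⟨f, hf⟩ | h
      swap
      · exact Or.inr h
      rcases hsub (X \ Y) Finset.sdiff_subset (by
        intro h
        obtain ⟨y, hy⟩ := hYne
        exact (Finset.mem_sdiff.1 (h.symm ▸ hY hy : y ∈ X \ Y)).2 hy) with ⟨g, hg⟩ | h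
      swap
      · exact Or.inr h
      refine Or.inl ⟨fun x => if x ∈ Y then f x else g x, fun x hx => ?_, fun x hx y hy hxy => ?_⟩
      · dsimp only
        split_ifs with hxY
        · exact hf.1 x hxY
        · exact hg.1 x (Finset.mem_sdiff.2 ⟨hx, hxY⟩)
      · dsimp only
        split_ifs with hxY hyY hyY
        · exact hf.2 x hxY y hyY hxy
        · exact absurd hxy (hno x hxY y hy hyY)
        · exact absurd hxy.symm (hno y hyY x hx hxY)
        · exact hg.2 x (Finset.mem_sdiff.2 ⟨hx, hxY⟩) y (Finset.mem_sdiff.2 ⟨hy, hyY⟩) hxy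

end Brooks

/-! ### Seven-vertex digraphs and the acyclic set -/

section Digraph

variable {V : Type*} {α : Type*}

open scoped Classical in
theorem sum_card_filter_mem_comm (N : V → Finset V) (Y : Finset V) :
    ∑ x ∈ Y, (Y.filter fun w => w ∈ N x).card = ∑ x ∈ Y, (Y.filter fun w => x ∈ N w).card :=
  Finset.sum_card_bipartiteAbove_eq_sum_card_bipartiteBelow fun x w => w ∈ N x

open scoped Classical in
/-- A digraph on seven vertices, all of whose outdegrees are odd or zero, has a majority coloring with
three colors. -/
theorem exists_majority_coloring_of_seven (N : V → Finset V) (Q : Finset V) (hQ : Q.card = 7)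
    (hNQ : ∀ v ∈ Q, N v ⊆ Q) (hloop : ∀ v, v ∉ N v)
    (hodd : ∀ v, Odd (N v).card ∨ N v = ∅) (T : Finset α) (hT : T.card = 3) :
    ∃ c : V → α, (∀ v ∈ Q, c v ∈ T) ∧
      ∀ v ∈ Q, ((N v).filter fun w => c w = c v).card ≤ (N v).card / 2 := by
  obtain ⟨x, y, z, hxy, hxz, hyz, rfl⟩ := Finset.card_eq_three.1 hT
  by_cases hr : ∃ r ∈ Q, (Q.filter fun w => r ∈ N w).card ≤ 4
  · obtain ⟨r, hrQ, hr⟩ := hr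
    -- Besides `r` and its at most four in-neighbors, two vertices remain. They absorb the pairs
    -- `(x, y)` and `(y, x)`, which leaves the unordered pair `{x, y}` free for `r`; the complete
    -- graph `K` forces all pairs outside `r` to be distinct.
    have h1 : 1 < ((Q.erase r) \ (Q.filter fun w => r ∈ N w)).card := by
      have := Finset.le_card_sdiff (Q.filter fun w => r ∈ N w) (Q.erase r)
      rw [Finset.card_erase_of_mem hrQ] at this
      omega
    obtain ⟨u₁, hu₁, u₂, hu₂, hu⟩ := Finset.one_lt_card.1 h1
    simp only [Finset.mem_sdiff, Finset.mem_erase, Finset.mem_filter, not_and] at hu₁ hu₂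
    have hoff : ({x, y, z} : Finset α).offDiag.card = 6 := by
      rw [Finset.offDiag_card, hT]
    obtain ⟨K, hK⟩ : ∃ K : SimpleGraph V, ∀ a b, K.Adj a b ↔ a ≠ b := ⟨⊤, fun _ _ => Iff.rfl⟩
    have hcol : IsListColoringOn K (fun _ => ({x, y, z} : Finset α).offDiag)
        {u₁, u₂} (fun v => if v = u₁ then (x, y) else (y, x)) := by
      refine ⟨fun v hv => ?_, fun a ha b hb hab => ?_⟩
      · dsimp only
        split_ifs <;> simp [Finset.mem_offDiag, hxy, hxy.symm]
      · simp only [Finset.mem_insert, Finset.mem_singleton] at ha hb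
        rcases ha with rfl | rfl <;> rcases hb with rfl | rfl
        · exact absurd hab (SimpleGraph.irrefl _)
        · simp [hu.symm, hxy]
        · simp [hu.symm, hxy.symm]
        · exact absurd hab (SimpleGraph.irrefl _)
    have hsub : ({u₁, u₂} : Finset V) ⊆ Q.erase r := by
      intro v hv
      simp only [Finset.mem_insert, Finset.mem_singleton] at hv
      rw [Finset.mem_erase]
      rcases hv with rfl | rfl
      exacts [hu₁.1, hu₂.1]
    obtain ⟨P, hP, hcolP⟩ := hcol.extend_of_degenerate (Q.erase r \ {u₁, u₂})
      Finset.disjoint_sdiff (by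
        intro Y hY hYne
        obtain ⟨v, hv⟩ := hYne
        refine ⟨v, hv, ?_⟩
        have hvm : v ∈ Q.erase r := (Finset.mem_sdiff.1 (hY hv)).1
        have hlt : ((Q.erase r).erase v).card < ({x, y, z} : Finset α).offDiag.card := by
          rw [Finset.card_erase_of_mem hvm, Finset.card_erase_of_mem hrQ, hoff]
          omega
        refine (Finset.card_le_card fun w hw => ?_).trans_lt hlt
        rw [Finset.mem_filter, hK] at hw
        exact Finset.mem_erase.2 ⟨hw.2.symm,
          Finset.union_subset hsub (hY.trans Finset.sdiff_subset) hw.1⟩)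
    rw [Finset.union_sdiff_of_subset hsub] at hcolP
    have hP₁ : P u₁ = (x, y) := by rw [hP u₁ (by simp)]; simp
    have hP₂ : P u₂ = (y, x) := by rw [hP u₂ (by simp)]; simp [hu.symm]
    have hmem := fun v hv => Finset.mem_offDiag.1 (hcolP.1 v hv)
    obtain ⟨c, -, hcO, hcF, hc⟩ := exists_coloring_of_pairs N (fun v => (N v).card / 2)
      (fun _ => x) (Q.erase r) {r} (by simp) P (fun _ => (x, y)) (fun v hv => (hmem v hv).2.2)
      (fun _ _ => hxy) (fun _ => 0)
      (fun v hv w hw hwr => by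
        rw [Finset.mem_singleton] at hv hwr
        subst hv; subst hwr
        exact absurd hw (hloop w))
      (fun v _ => by omega)
      (fun v hv w hw hwO => hcolP.2 w hwO v hv (by
        rw [hK]; rintro rfl; exact hloop w hw))
      (fun v hv w hw hwr => by
        rw [Finset.mem_singleton] at hwr
        subst hwr
        have hv₁ : v ≠ u₁ := by
          rintro rfl; exact hu₁.2 (Finset.mem_of_mem_erase hv) hw
        have hv₂ : v ≠ u₂ := by
          rintro rfl; exact hu₂.2 (Finset.mem_of_mem_erase hv) hw
        refine ⟨fun h => ?_, fun h => ?_⟩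
        · exact hcolP.2 v hv u₁ (hsub (by simp)) ((hK _ _).2 hv₁) (by rw [hP₁, ← h])
        · refine hcolP.2 v hv u₂ (hsub (by simp)) ((hK _ _).2 hv₂) ?_
          rw [hP₂, ← Prod.swap_swap (P v), ← h]
          rfl)
    refine ⟨c, fun v hv => ?_, fun v hv => hc v ?_⟩
    · by_cases hvr : v = r
      · rcases hcF v (by simpa using hvr) with h | h <;> simp [h]
      · have hvO : v ∈ Q.erase r := Finset.mem_erase.2 ⟨hvr, hv⟩
        rcases hcO v hvO with h | h <;> rw [h]
        exacts [(hmem v hvO).1, (hmem v hvO).2.1]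
    · by_cases hvr : v = r
      · exact Or.inr (by simpa using hvr)
      · exact Or.inl (Finset.mem_erase.2 ⟨hvr, hv⟩)
  -- All in-degrees are at least five and all out-degrees, being odd or zero, at most five. Double
  -- counting makes every out-degree five, so color classes of sizes 3, 2, 2 suffice.
  · push Not at hr
    have hle5 : ∀ v ∈ Q, (N v).card ≤ 5 := by
      intro v hv
      have hsub : N v ⊆ Q.erase v := fun w hw =>
        Finset.mem_erase.2 ⟨by rintro rfl; exact hloop w hw, hNQ v hv hw⟩
      have h1 := Finset.card_le_card hsub
      rw [Finset.card_erase_of_mem hv, hQ] at h1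
      rcases hodd v with ⟨m, hm⟩ | h
      · omega
      · simp [h]
    have hsum : ∑ v ∈ Q, (N v).card = ∑ v ∈ Q, 5 := by
      refine le_antisymm (Finset.sum_le_sum hle5) ?_
      have h2 : ∑ v ∈ Q, (Q.filter fun w => w ∈ N v).card = ∑ v ∈ Q, (N v).card := by
        refine Finset.sum_congr rfl fun v hv => ?_
        congr 1
        ext w
        simpa using fun hw => hNQ v hv hw
      rw [← h2, sum_card_filter_mem_comm]
      exact Finset.sum_le_sum fun v hv => hr v hv
    have h5 := (Finset.sum_eq_sum_iff_of_le hle5).1 hsum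
    obtain ⟨A, hA, hAc⟩ := Finset.exists_subset_card_eq (show 3 ≤ Q.card by omega)
    have hQA : (Q \ A).card = 4 := by rw [Finset.card_sdiff_of_subset hA]; omega
    obtain ⟨B, hB, hBc⟩ := Finset.exists_subset_card_eq (show 2 ≤ (Q \ A).card by omega)
    have hC : ((Q \ A) \ B).card = 2 := by rw [Finset.card_sdiff_of_subset hB]; omega
    refine ⟨fun v => if v ∈ A then x else if v ∈ B then y else z, fun v _ => ?_, fun v hv => ?_⟩
    · dsimp only
      split_ifs <;> simp
    · obtain ⟨E, hvE, hE, hsub⟩ : ∃ E : Finset V, v ∈ E ∧ E.card ≤ 3 ∧ ∀ w ∈ Q,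
          (if w ∈ A then x else if w ∈ B then y else z) =
            (if v ∈ A then x else if v ∈ B then y else z) → w ∈ E := by
        by_cases hvA : v ∈ A
        · refine ⟨A, hvA, hAc.le, fun w _ h => ?_⟩
          simp only [hvA, if_true] at h
          split_ifs at h
          exacts [‹w ∈ A›, absurd h hxy.symm, absurd h hxz.symm]
        · by_cases hvB : v ∈ B
          · refine ⟨B, hvB, by omega, fun w _ h => ?_⟩
            simp only [hvA, hvB, if_true, if_false] at h
            split_ifs at h
            exacts [absurd h hxy, ‹w ∈ B›, absurd h hyz.symm]
          · refine ⟨(Q \ A) \ B, by simp [hv, hvA, hvB], by omega, fun w hw h => ?_⟩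
            simp only [hvA, hvB, if_false] at h
            split_ifs at h
            exacts [absurd h hxz, absurd h hyz, by simp [*]]
      have h6 : ((N v).filter fun w => (if w ∈ A then x else if w ∈ B then y else z) =
          (if v ∈ A then x else if v ∈ B then y else z)) ⊆ E.erase v := by
        intro w hw
        rw [Finset.mem_filter] at hw
        exact Finset.mem_erase.2 ⟨by rintro rfl; exact hloop w hw.1, hsub w (hNQ v hv hw.1) hw.2⟩
      have h7 := Finset.card_le_card h6
      rw [Finset.card_erase_of_mem hvE] at h7
      rw [h5 v hv]
      dsimp only
      omega

open scoped Classical in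
/-- Among the vertices outside `S` there is an acyclic set `F` of vertices with indegree at most two
such that every subgraph of minimum degree six outside `S` and `F` is `6`-regular and has no leaving arc. -/
theorem exists_acyclic_set [Fintype V] (N : V → Finset V) (hloop : ∀ v, v ∉ N v)
    (hodd : ∀ v, Odd (N v).card ∨ N v = ∅) (G : SimpleGraph V)
    (hG : ∀ v w, G.Adj v w ↔ w ∈ N v ∨ v ∈ N w)
    (h : (∀ v, (Finset.univ.filter (G.Adj v)).card ≤ 6) ∨
      ∀ v, (N v).card ≤ 3 ∨ (N v).card + (Finset.univ.filter fun w => v ∈ N w).card ≤ 7)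
    (S : Finset V) :
    ∃ (F : Finset V) (ρ : V → ℕ), Disjoint F S ∧ (∀ v ∈ F, ∀ w ∈ N v, w ∈ F → ρ w < ρ v) ∧
      (∀ v ∈ F, (Finset.univ.filter fun w => v ∈ N w).card ≤ 2) ∧
      ∀ Y : Finset V, Disjoint Y S → Disjoint Y F → (∀ x ∈ Y, 6 ≤ (Y.filter (G.Adj x)).card) →
        ∀ x ∈ Y, (Y.filter (G.Adj x)).card = 6 ∧ N x ⊆ Y := by
  rcases h with h | h
  · refine ⟨∅, fun _ => 0, by simp, by simp, by simp, fun Y _ _ hY x hx => ?_⟩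
    have hsub : Y.filter (G.Adj x) ⊆ Finset.univ.filter (G.Adj x) :=
      Finset.filter_subset_filter _ (Finset.subset_univ _)
    have heq := Finset.eq_of_subset_of_card_le hsub ((h x).trans (hY x hx))
    refine ⟨le_antisymm (heq ▸ h x) (hY x hx), fun w hw => ?_⟩
    have hmem : w ∈ Finset.univ.filter (G.Adj x) :=
      Finset.mem_filter.2 ⟨Finset.mem_univ _, (hG x w).2 (Or.inl hw)⟩
    rw [← heq] at hmem
    exact (Finset.mem_filter.1 hmem).1
  · let big : Finset V := Finset.univ.filter fun v => v ∉ S ∧ 5 ≤ (N v).card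
    have hbig : ∀ v, v ∈ big ↔ v ∉ S ∧ 5 ≤ (N v).card := fun v => by simp [big]
    -- By maximality, a big vertex outside `F` has an out-neighbor in `F` (else it could be added,
    -- with `F` ranked above it or not pointed to by it) and an in-neighbor in `F` (else it could be
    -- added at the top).
    obtain ⟨F, hF, hmax⟩ := Finset.exists_max_image
      (big.powerset.filter fun F => ∃ ρ : V → ℕ, ∀ v ∈ F, ∀ w ∈ N v, w ∈ F → ρ w < ρ v)
      Finset.card ⟨∅, by simp⟩
    simp only [Finset.mem_filter, Finset.mem_powerset] at hF hmax
    obtain ⟨hFbig, ρ, hρ⟩ := hF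
    have hins : ∀ v ∈ big, v ∉ F → ¬ ∃ ρ : V → ℕ, ∀ u ∈ insert v F, ∀ w ∈ N u, w ∈ insert v F →
        ρ w < ρ u := by
      intro v hv hvF hex
      have := hmax (insert v F) ⟨Finset.insert_subset hv hFbig, hex⟩
      rw [Finset.card_insert_of_notMem hvF] at this
      omega
    have hout : ∀ v ∈ big, v ∉ F → ∃ w ∈ F, w ∈ N v := by
      intro v hv hvF
      by_contra hno
      push Not at hno
      refine hins v hv hvF ⟨fun u => if u = v then 0 else ρ u + 1, fun u hu w hw hwF => ?_⟩
      rw [Finset.mem_insert] at hu hwF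
      have huv : u ≠ v := by
        rintro rfl
        rcases hwF with rfl | hwF
        exacts [hloop w hw, hno w hwF hw]
      have huF := hu.resolve_left huv
      dsimp only
      rw [if_neg huv]
      split_ifs with hwv
      · omega
      · have := hρ u huF w hw (hwF.resolve_left hwv)
        omega
    have hin : ∀ v ∈ big, v ∉ F → ∃ u ∈ F, v ∈ N u := by
      intro v hv hvF
      by_contra hno
      push Not at hno
      refine hins v hv hvF ⟨fun u => if u = v then F.sup ρ + 1 else ρ u, fun u hu w hw hwF => ?_⟩
      rw [Finset.mem_insert] at hu hwF
      have hwv : w ≠ v := by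
        rintro rfl
        rcases hu with rfl | hu
        exacts [hloop u hw, hno u hu hw]
      have hwF' := hwF.resolve_left hwv
      dsimp only
      rw [if_neg hwv]
      split_ifs with huv
      · exact Nat.lt_succ_of_le (Finset.le_sup (f := ρ) hwF')
      · exact hρ u (hu.resolve_left huv) w hw hwF'
    refine ⟨F, ρ, ?_, hρ, fun v hv => ?_, fun Y hYS hYF hY => ?_⟩
    · rw [Finset.disjoint_left]
      exact fun v hv => ((hbig v).1 (hFbig hv)).1
    · have h1 := ((hbig v).1 (hFbig hv)).2
      rcases h v with h2 | h2 <;> omega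
    have hNF : ∀ x ∈ Y, ∀ w ∈ F, w ∉ Y.filter (G.Adj x) := fun x _ w hw hwY =>
      Finset.disjoint_left.1 hYF (Finset.mem_filter.1 hwY).1 hw
    -- A larger out-degree is at least five by parity. Such a vertex sends an arc to `F` and
    -- receives one from `F`, so at most `7 - 2 = 5` neighbors remain in `Y`.
    have h3 : ∀ x ∈ Y, (N x).card ≤ 3 := by
      intro x hx
      have hxF : x ∉ F := Finset.disjoint_left.1 hYF hx
      by_contra hgt
      have hxbig : x ∈ big := by
        rw [hbig]
        refine ⟨Finset.disjoint_left.1 hYS hx, ?_⟩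
        rcases hodd x with ⟨m, hm⟩ | h0
        · omega
        · simp [h0] at hgt
      obtain ⟨w, hwF, hwx⟩ := hout x hxbig hxF
      obtain ⟨u, huF, hux⟩ := hin x hxbig hxF
      have hsub : Y.filter (G.Adj x) ⊆ (N x).erase w ∪ (Finset.univ.filter fun w => x ∈ N w).erase u := by
        intro y hy
        have hyw : y ≠ w := by rintro rfl; exact hNF x hx y hwF hy
        have hyu : y ≠ u := by rintro rfl; exact hNF x hx y huF hy
        have := (hG x y).1 (Finset.mem_filter.1 hy).2
        simp only [Finset.mem_union, Finset.mem_erase, Finset.mem_filter, Finset.mem_univ, true_and]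
        tauto
      have h4 := (Finset.card_le_card hsub).trans (Finset.card_union_le _ _)
      have hum : u ∈ Finset.univ.filter fun w => x ∈ N w := by simpa using hux
      rw [Finset.card_erase_of_mem hwx, Finset.card_erase_of_mem hum] at h4
      have h5 := hY x hx
      have h6 : 0 < (N x).card := Finset.card_pos.2 ⟨w, hwx⟩
      have h7 := Finset.card_pos.2 ⟨u, hum⟩
      rcases h x with h8 | h8 <;> omega
    have hdY : ∀ x ∈ Y, (Y.filter fun w => w ∈ N x).card ≤ 3 := fun x hx =>
      (Finset.card_le_card fun w hw => (Finset.mem_filter.1 hw).2).trans (h3 x hx)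
    have hsplit : ∀ x ∈ Y, (Y.filter (G.Adj x)).card ≤
        (Y.filter fun w => w ∈ N x).card + (Y.filter fun w => x ∈ N w).card := by
      intro x _
      refine le_trans (Finset.card_le_card fun w hw => ?_) (Finset.card_union_le _ _)
      rw [Finset.mem_filter, hG] at hw
      simp only [Finset.mem_union, Finset.mem_filter]
      tauto
    -- The degree sum in `Y` is at most twice the number of arcs, hence at most `6 * Y.card`;
    -- equality holds throughout, so all three out-arcs of each vertex stay in `Y`.
    have hs1 : ∑ x ∈ Y, (Y.filter (G.Adj x)).card ≤ 2 * ∑ x ∈ Y, (Y.filter fun w => w ∈ N x).card := by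
      refine (Finset.sum_le_sum hsplit).trans ?_
      rw [Finset.sum_add_distrib, ← sum_card_filter_mem_comm]
      omega
    have hs2 : ∑ x ∈ Y, (Y.filter fun w => w ∈ N x).card ≤ ∑ x ∈ Y, 3 := Finset.sum_le_sum hdY
    have hs3 : ∑ x ∈ Y, 6 ≤ ∑ x ∈ Y, (Y.filter (G.Adj x)).card := Finset.sum_le_sum hY
    have hconst : ∑ x ∈ Y, 6 = 2 * ∑ x ∈ Y, 3 := by simp only [Finset.sum_const, smul_eq_mul]; ring
    have he1 := (Finset.sum_eq_sum_iff_of_le hdY).1 (by omega)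
    have he2 := (Finset.sum_eq_sum_iff_of_le hY).1 (by omega)
    refine fun x hx => ⟨(he2 x hx).symm, ?_⟩
    have hsub : (Y.filter fun w => w ∈ N x) ⊆ N x := fun w hw => (Finset.mem_filter.1 hw).2
    have heq := Finset.eq_of_subset_of_card_le hsub (by rw [he1 x hx]; exact h3 x hx)
    rw [← heq]
    exact Finset.filter_subset _ _

end Digraph

/-! ### Assembly of the coloring -/

section Main

open scoped Classical in
theorem exists_majority_coloring_of_odd {V : Type*} {α : Type*} [Fintype V] (N : V → Finset V)
    (hloop : ∀ v, v ∉ N v) (hodd : ∀ v, Odd (N v).card ∨ N v = ∅) (G : SimpleGraph V)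
    (hG : ∀ v w, G.Adj v w ↔ w ∈ N v ∨ v ∈ N w)
    (h : (∀ v, (Finset.univ.filter (G.Adj v)).card ≤ 6) ∨
      ∀ v, (N v).card ≤ 3 ∨ (N v).card + (Finset.univ.filter fun w => v ∈ N w).card ≤ 7)
    (L : V → Finset α) (hL : ∀ v, (L v).card = 3) :
    ∃ c : V → α, (∀ v, c v ∈ L v) ∧
      ∀ v, ((N v).filter fun w => c w = c v).card ≤ (N v).card / 2 := by
  rcases isEmpty_or_nonempty V with hV | ⟨⟨v₀⟩⟩
  · exact ⟨fun v => hV.elim v, fun v => hV.elim v, fun v => hV.elim v⟩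
  obtain ⟨α₀, -⟩ : (L v₀).Nonempty := by rw [← Finset.card_pos, hL]; omega
  -- Because `S` is closed under out-neighbors, its coloring stays valid however the rest is
  -- colored.
  let sat : Finset V → Prop := fun S => (∀ v ∈ S, N v ⊆ S) ∧ ∃ g : V → α, ∀ v ∈ S, g v ∈ L v ∧
    ((N v).filter fun w => g w = g v).card ≤ (N v).card / 2
  obtain ⟨S, hS, hmax⟩ := Finset.exists_max_image (Finset.univ.filter sat) Finset.card
    ⟨∅, Finset.mem_filter.2 ⟨Finset.mem_univ _, by simp, fun _ => α₀, by simp⟩⟩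
  simp only [Finset.mem_filter, Finset.mem_univ, true_and] at hS hmax
  obtain ⟨hSN, g, hg⟩ := hS
  have hno : ∀ Q : Finset V, Disjoint Q S → Q.card = 7 → (∀ v ∈ Q, N v ⊆ Q) →
      ¬ ∃ T, ∀ x ∈ Q, L x = T := by
    rintro Q hQS hQ hNQ ⟨T, hT⟩
    obtain ⟨q, hq⟩ : Q.Nonempty := by rw [← Finset.card_pos]; omega
    obtain ⟨c, hcT, hc⟩ := exists_majority_coloring_of_seven N Q hQ hNQ hloop hodd T (hT q hq ▸ hL q)
    have hle := hmax (Q ∪ S) ⟨fun v hv => ?_, fun v => if v ∈ Q then c v else g v, fun v hv => ?_⟩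
    · rw [Finset.card_union_of_disjoint hQS] at hle
      omega
    · rw [Finset.mem_union] at hv
      rcases hv with hv | hv
      · exact (hNQ v hv).trans Finset.subset_union_left
      · exact (hSN v hv).trans Finset.subset_union_right
    · by_cases hvQ : v ∈ Q
      · have : ((N v).filter fun w => (if w ∈ Q then c w else g w) = c v) =
            (N v).filter fun w => c w = c v :=
          Finset.filter_congr fun w hw => by rw [if_pos (hNQ v hvQ hw)]
        simp only [hvQ, if_true, this]
        exact ⟨hT v hvQ ▸ hcT v hvQ, hc v hvQ⟩
      · have hvS := (Finset.mem_union.1 hv).resolve_left hvQ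
        have : ((N v).filter fun w => (if w ∈ Q then c w else g w) = g v) =
            (N v).filter fun w => g w = g v :=
          Finset.filter_congr fun w hw => by
            rw [if_neg fun hwQ => Finset.disjoint_left.1 hQS hwQ (hSN v hvS hw)]
        simp only [hvQ, if_false, this]
        exact hg v hvS
  obtain ⟨F, ρ, hFS, hρ, hFin, hcore⟩ := exists_acyclic_set N hloop hodd G hG h S
  have hoff : ∀ v, (L v).offDiag.card = 6 := fun v => by rw [Finset.offDiag_card, hL]
  let O : Finset V := Finset.univ \ (S ∪ F)
  have hO : ∀ v, v ∈ O ↔ v ∉ S ∧ v ∉ F := fun v => by simp [O]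
  -- `W` is the 6-core of `O`: Brooks' theorem colors it, and by maximality the rest of `O` is added
  -- greedily.
  obtain ⟨W, hW, hWmax⟩ := Finset.exists_max_image
    (O.powerset.filter fun Y => ∀ x ∈ Y, 6 ≤ (Y.filter (G.Adj x)).card) Finset.card
    ⟨∅, by simp⟩
  simp only [Finset.mem_filter, Finset.mem_powerset] at hW hWmax
  obtain ⟨hWO, hW6⟩ := hW
  have hWS : Disjoint W S := Finset.disjoint_left.2 fun v hv => ((hO v).1 (hWO hv)).1
  have hWF : Disjoint W F := Finset.disjoint_left.2 fun v hv => ((hO v).1 (hWO hv)).2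
  have hWreg := hcore W hWS hWF hW6
  obtain ⟨P₀, hP₀⟩ : ∃ P, IsListColoringOn G (fun v => (L v).offDiag) W P := by
    rcases exists_listColoring_or_clique (G := G) (Λ := fun v => (L v).offDiag) (k := 6) (by norm_num)
      W (fun v _ => hoff v) (fun v hv => (hWreg v hv).1.le) ⟨(α₀, α₀)⟩ with
      h | ⟨Q, hQW, hQ, hclique, T, hT⟩
    · exact h
    -- In the 6-regular `W`, a clique on seven vertices contains all neighbors of its members, so it
    -- is closed under out-neighbors. Equal sets of ordered pairs come from equal lists, recovered
    -- as first coordinates.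
    · refine absurd ?_ (hno Q (Finset.disjoint_of_subset_left hQW hWS) hQ fun v hv w hw => ?_)
      · refine ⟨T.image Prod.fst, fun x hx => ?_⟩
        rw [← hT x hx]
        ext a
        simp only [Finset.mem_image, Finset.mem_offDiag, Prod.exists, exists_and_right,
          exists_eq_right]
        refine ⟨fun ha => ?_, fun ⟨_, ha⟩ => ha.1⟩
        obtain ⟨b, hb, hba⟩ := Finset.exists_mem_ne (by rw [hL]; omega : 1 < (L x).card) a
        exact ⟨b, ha, hb, hba.symm⟩
      · have hsub : Q.erase v ⊆ W.filter (G.Adj v) := by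
          intro y hy
          rw [Finset.mem_erase] at hy
          exact Finset.mem_filter.2 ⟨hQW hy.2, hclique v hv y hy.2 hy.1.symm⟩
        have heq := Finset.eq_of_subset_of_card_le hsub (by
          rw [(hWreg v (hQW hv)).1, Finset.card_erase_of_mem hv, hQ])
        have hmem : w ∈ W.filter (G.Adj v) :=
          Finset.mem_filter.2 ⟨(hWreg v (hQW hv)).2 hw, (hG v w).2 (Or.inl hw)⟩
        rw [← heq] at hmem
        exact Finset.mem_of_mem_erase hmem
  obtain ⟨P, -, hP⟩ := hP₀.extend_of_degenerate (O \ W) Finset.disjoint_sdiff (by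
    intro Z hZ hZne
    by_contra hbig
    push Not at hbig
    have hZO : Z ⊆ O := hZ.trans Finset.sdiff_subset
    have hdis : Disjoint W Z := Finset.disjoint_of_subset_right hZ Finset.disjoint_sdiff
    have hle := hWmax (W ∪ Z) ⟨Finset.union_subset hWO hZO, fun x hx => by
      rw [Finset.mem_union] at hx
      rcases hx with hx | hx
      · exact (hW6 x hx).trans (Finset.card_le_card
          (Finset.filter_subset_filter _ Finset.subset_union_left))
      · rw [← hoff x]
        exact hbig x hx⟩
    rw [Finset.card_union_of_disjoint hdis] at hle
    have := hZne.card_pos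
    omega)
  rw [Finset.union_sdiff_of_subset hWO] at hP
  have hflex : ∀ v, ∃ r : α × α, v ∈ F → r ∈ (L v).offDiag ∧ ∀ u, v ∈ N u → r ≠ P u ∧ r ≠ (P u).swap := by
    intro v
    by_cases hv : v ∈ F
    · let I : Finset V := Finset.univ.filter fun u => v ∈ N u
      -- At most two in-neighbors forbid at most four of the six ordered pairs.
      have hcard : (I.image P ∪ I.image fun u => (P u).swap).card < (L v).offDiag.card := by
        refine (Finset.card_union_le _ _).trans_lt ?_
        have h1 := Finset.card_image_le (s := I) (f := P)
        have h2 := Finset.card_image_le (s := I) (f := fun u => (P u).swap)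
        have h3 : I.card ≤ 2 := hFin v hv
        rw [hoff]
        omega
      obtain ⟨r, hr, hrI⟩ := Finset.exists_mem_notMem_of_card_lt_card hcard
      simp only [Finset.mem_union, Finset.mem_image, not_or, not_exists, not_and] at hrI
      have hI : ∀ u, v ∈ N u → u ∈ I := fun u hu => by simpa [I] using hu
      exact ⟨r, fun _ => ⟨hr, fun u hu =>
        ⟨fun he => hrI.1 u (hI u hu) he.symm, fun he => hrI.2 u (hI u hu) he.symm⟩⟩⟩
    · exact ⟨(α₀, α₀), fun h => absurd h hv⟩
  choose R hR using hflex
  have hPm := fun v hv => Finset.mem_offDiag.1 (hP.1 v hv)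
  have hRm := fun v hv => Finset.mem_offDiag.1 (hR v hv).1
  obtain ⟨c, hcS, hcO, hcF, hc⟩ := exists_coloring_of_pairs N (fun v => (N v).card / 2) g O F
    (Finset.disjoint_left.2 fun v hv => ((hO v).1 hv).2) P R (fun v hv => (hPm v hv).2.2)
    (fun v hv => (hRm v hv).2.2) ρ hρ (fun v _ => by omega)
    (fun v hv w hw hwO => hP.2 w hwO v hv ((hG w v).2 (Or.inr hw)))
    (fun v _ w hw hwF => (hR w hwF).2 v hw)
  have hcg : ∀ v ∈ S, c v = g v := fun v hv =>
    hcS v (fun hvO => ((hO v).1 hvO).1 hv) fun hvF => Finset.disjoint_left.1 hFS hvF hv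
  have hcases : ∀ v, v ∈ S ∨ v ∈ O ∨ v ∈ F := fun v => by rw [hO]; tauto
  refine ⟨c, fun v => ?_, fun v => ?_⟩
  · rcases hcases v with hv | hv | hv
    · rw [hcg v hv]; exact (hg v hv).1
    · rcases hcO v hv with h | h <;> rw [h]
      exacts [(hPm v hv).1, (hPm v hv).2.1]
    · rcases hcF v hv with h | h <;> rw [h]
      exacts [(hRm v hv).1, (hRm v hv).2.1]
  · rcases hcases v with hv | hv
    · have : ((N v).filter fun w => c w = c v) = (N v).filter fun w => g w = g v :=
        Finset.filter_congr fun w hw => by rw [hcg v hv, hcg w (hSN v hv hw)]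
      rw [this]
      exact (hg v hv).2
    · exact hc v hv

/-- Dropping at most one element makes the cardinality of a nonempty finite set odd. -/
theorem exists_odd_subset {V : Type*} (M : Finset V) : ∃ M' ⊆ M, (Odd M'.card ∨ M' = ∅) ∧
    M.card + M'.card / 2 ≤ M'.card + M.card / 2 := by
  classical
  rcases Nat.even_or_odd M.card with he | ho
  · rcases M.eq_empty_or_nonempty with rfl | ⟨x, hx⟩
    · exact ⟨∅, subset_rfl, Or.inr rfl, by simp⟩
    · have hpos : 0 < M.card := Finset.card_pos.2 ⟨x, hx⟩
      obtain ⟨m, hm⟩ := he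
      refine ⟨M.erase x, Finset.erase_subset _ _, Or.inl ?_, ?_⟩
      · rw [Finset.card_erase_of_mem hx]
        exact ⟨m - 1, by omega⟩
      · rw [Finset.card_erase_of_mem hx]
        omega
  · exact ⟨M, subset_rfl, Or.inl ho, le_rfl⟩

open scoped Classical in
theorem exists_majority_coloring {V : Type*} {α : Type*} [Fintype V] (D : Digraph V)
    (loopless : ∀ v, ¬ D.Adj v v) [DecidableRel D.toSimpleGraphInclusive.Adj]
    (h : D.maxOutDeg ≤ 4 ∨ D.toSimpleGraphInclusive.maxDegree ≤ 6 ∨ D.maxDeg ≤ 7)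
    (L : V → Finset α) (hL : ∀ v, 3 ≤ (L v).card) :
    ∃ c : V → α, (∀ v, c v ∈ L v) ∧ D.IsMajorityColoring c := by
  -- Lists of size exactly three give exactly six ordered pairs, the constant list size for Brooks'
  -- theorem.
  choose L' hL'L hL' using fun v => Finset.exists_subset_card_eq (hL v)
  choose N hND hodd hNcard using fun v => exists_odd_subset (D.outNeighbors v)
  have hmem : ∀ v w, w ∈ N v → D.Adj v w := fun v w hw => by
    have := hND v hw
    rw [Digraph.outNeighbors, Finset.mem_filter] at this
    exact this.2
  have hloop : ∀ v, v ∉ N v := fun v hv => loopless v (hmem v v hv)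
  obtain ⟨G, hG⟩ : ∃ G : SimpleGraph V, ∀ v w, G.Adj v w ↔ w ∈ N v ∨ v ∈ N w := by
    refine ⟨SimpleGraph.fromRel fun v w => w ∈ N v, fun v w => ?_⟩
    rw [SimpleGraph.fromRel_adj]
    refine ⟨fun h => h.2, fun h => ⟨?_, h⟩⟩
    rintro rfl
    exact hloop v (h.elim id id)
  have hin : ∀ v, (Finset.univ.filter fun w => v ∈ N w).card ≤ D.inDeg v := fun v => by
    refine Finset.card_le_card fun w hw => ?_
    rw [Finset.mem_filter] at hw
    rw [Digraph.inNeighbors, Finset.mem_filter]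
    exact ⟨hw.1, hmem w v hw.2⟩
  have hout : ∀ v, (N v).card ≤ D.outDeg v := fun v => Finset.card_le_card (hND v)
  obtain ⟨c, hcL, hc⟩ := exists_majority_coloring_of_odd N hloop hodd G hG (by
    rcases h with h | h | h
    -- Out-degree at most four becomes at most three after trimming, by parity.
    · refine Or.inr fun v => Or.inl ?_
      have h1 : D.outDeg v ≤ D.maxOutDeg :=
        Finset.le_sup (f := fun v => D.outDeg v) (Finset.mem_univ v)
      have h2 := hout v
      rcases hodd v with ⟨m, hm⟩ | h0
      · omega
      · simp [h0]
    · refine Or.inl fun v => le_trans ?_ ((D.toSimpleGraphInclusive.degree_le_maxDegree v).trans h)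
      rw [← SimpleGraph.card_neighborFinset_eq_degree]
      refine Finset.card_le_card fun w hw => ?_
      rw [Finset.mem_filter] at hw
      rw [SimpleGraph.mem_neighborFinset, Digraph.toSimpleGraphInclusive, SimpleGraph.fromRel_adj]
      exact ⟨hw.2.ne, ((hG v w).1 hw.2).imp (hmem v w) (hmem w v)⟩
    · refine Or.inr fun v => Or.inr ?_
      have h1 : D.outDeg v + D.inDeg v ≤ D.maxDeg :=
        Finset.le_sup (f := fun v => D.outDeg v + D.inDeg v) (Finset.mem_univ v)
      have h2 := hout v
      have h3 := hin v
      omega) L' hL'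
  refine ⟨c, fun v => hL'L v (hcL v), fun v => ?_⟩
  -- Even if the dropped out-neighbor shares the color of `v`, the count stays within half of the
  -- original out-degree.
  have h1 : ((D.outNeighbors v).filter fun w => c w = c v).card ≤
      ((N v).filter fun w => c w = c v).card + (D.outNeighbors v \ N v).card := by
    refine le_trans (Finset.card_le_card fun w hw => ?_) (Finset.card_union_le _ _)
    simp only [Finset.mem_filter, Finset.mem_union, Finset.mem_sdiff] at hw ⊢
    tauto
  rw [Finset.card_sdiff_of_subset (hND v)] at h1
  have h2 := hc v
  have h3 := hNcard v
  have h4 := Finset.card_le_card (hND v)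
  rw [Digraph.outDeg]
  omega

end Main

end MajorityColoring

theorem theorem3 {V : Type u} [Fintype V] (D : Digraph V)
    (loopless : ∀ v, ¬ D.Adj v v) [DecidableRel D.toSimpleGraphInclusive.Adj] :
    ((D.maxOutDeg ≤ 4 ∨ D.toSimpleGraphInclusive.maxDegree ≤ 6 ∨ D.maxDeg ≤ 7) →
      Digraph.IsMajorityChoosable.{u, w} D 3) ∧
    ((D.IsRegular 3 ∨ D.IsRegular 4) → D.IsMajorityColorable 3) := by
  refine ⟨fun h α L hL => MajorityColoring.exists_majority_coloring D loopless h L hL, fun h => ?_⟩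
  obtain ⟨c, -, hc⟩ := MajorityColoring.exists_majority_coloring D loopless
    (Or.inl (Finset.sup_le fun v _ => by
      rcases h with h | h
      · exact (h v).1.le.trans (by norm_num)
      · exact (h v).1.le)) (fun _ => (Finset.univ : Finset (Fin 3))) (fun _ => by simp)
  exact ⟨c, hc⟩
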